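/- **Model.** Let $\mathcal N$ be a finite set of mobile devices, time be slotted, $t=0,1,2,\dots$. The channel states $C(t)=(C^c(t),C^w(t))$ (cellular, local-area) are i.i.d. over the slots with law $P$. In cellular state $c$ the cellular links do not interfere and the link of device $k$ has a set $\Gamma^c_k(c)\subseteq\mathbb R$ of feasible rates; cellular rates $g_{k,s}^n\ge 0$ ($n\in\mathcal N$; the rate of the link of $k$ for the flow of $n$) are feasible if $\max_n g_{k,s}^n\in\Gamma^c_k(c)$. In the unicast setup, the local-area rates $\{g_{k,n}^k\}_{n\ne k}$ must lie in a set $\Gamma^w_u(C^w(t))$. In the broadcast setup there is a family $\mathcal H$ of sets of devices, rates $\{f_{n,J}\}$ must lie in $\Gamma^w_b(C^w(t))$, and $g_{k,n}^k=\sum_{J\in\mathcal H:\,k\in J,\,n\notin J}f_{n,J}$. It is assumed that the feasible sets depend measurably on the channel state, that local-area rates $g_{k,n}^k$ are nonnegative, that all-zero local-area rates are feasible, that the largest feasible rates have a finite second moment, and that each device is connected to the source by its own cellular link (some measurable choice $r(C^c(t))\in\Gamma^c_k(C^c(t))$, $r\ge0$, has positive mean). The virtual queues $\lambda_k$ and $\eta_{n,k}$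 and the real queues $Q_{n,k}$ ($n\neq k$) are nonnegative, have finite second moments at $t=0$, depend only on the past at the beginning of each slot (the channel state of a slot being independent of the past), and satisfy $$\lambda_k(t+1)\le\max\Big[\lambda_k(t)-g_{k,s}^k(t)-\sum_{n\ne k}g_{k,n}^k(t),0\Big]+y_k(t),\qquad \eta_{n,k}(t+1)\le\max[\eta_{n,k}(t)-g_{n,s}^k(t),0]+g_{k,n}^k(t),$$ $$Q_{n,k}(t+1)\le\max\big[\max[Q_{n,k}(t)-h_{n,k}(t),0]+x_{n,k}(t),\,0\big],\qquad h_{n,k}=g_{k,n}^k,\quad x_{n,k}=g_{n,s}^k-\beta,$$ where $\beta>0$ is a constant and $y_k(t)$ are the arrivals. **DcC.** In every slot, given $C(t)$ and the queues: * *Cellular scheduler:* each $k$ chooses feasible $\{g_{k,s}^n(t)\}_n$ maximizing $\lambda_k(t)g_{k,s}^k+\sum_{n\ne k}(\eta_{k,n}(t)-Q_{k,n}(t))g_{k,s}^n$. * *Local-area scheduler:* a feasible $\{g_{k,n}^k(t)\}$ (unicast), respectively $\{f_{n,J}(t)\}$ (broadcast), is chosen maximizing $\sum_k\sum_{n\ne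 k}[\lambda_k(t)-\eta_{n,k}(t)+Q_{n,k}(t)]\,g_{k,n}^k$, with $g_{k,n}^k=\sum_J f_{n,J}$ as above in broadcast. * *Rate control:* $y_k(t)$ maximizes $M\,U_k(z)-\lambda_k(t)z$ over $z\le R_k$ in the domain of $U_k$, where $M,R_k>0$ and $U_k$ is real-valued and strictly concave on its domain, $[0,\infty)$ or $(0,\infty)$. **Stability.** A process $X(t)$ is stable if $E|X(t)|<\infty$ for all $t$ and $\sup_{T\ge1}\frac1T\sum_{t<T}E|X(t)|<\infty$. The stability region (of the unicast, respectively the broadcast setup) is the set of all $A\in\mathbb R^{\mathcal N}$ such that for some nonnegative arrivals with $E[y_k(t)]=A_k$ for all $k,t$, and for i.i.d. channel states with law $P$, some scheduling policy (any choice of feasible rates in each slot) keeps all $\lambda_k$ and $\eta_{n,k}$ stable, when these evolve by the recursions above with equality. **Theorem.** Let $A$ be in the interior of the stability region, and let the cellular and local-area rates be chosen by the DcC schedulers. Suppose that either (a) the arrivals are exogenous: nonnegative, in each slot independent of the past, identically distributed over the slots, with $E[y_k(t)]=A_k$ and $E[y_k(t)^2]<\infty$; or (b) the arrivals are chosen by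 the DcC rate control (no condition on their means is needed, so in particular when $E[y_k(t)]=A_k$). Then, in the unicast and in the broadcast setup, DcC stabilizes the network: all queues $\lambda_k$, $\eta_{n,k}$, $Q_{n,k}$ ($n\ne k$) are stable, and the time-average expected total queue size is bounded, $$\sup_{T\ge1}\ \frac1T\sum_{t<T}E\Big[\sum_k\lambda_k(t)+\sum_k\sum_{n\ne k}\big(\eta_{n,k}(t)+Q_{n,k}(t)\big)\Big]<\infty .$$ -/

import Mathlib

open MeasureTheory ProbabilityTheory

universe u v

namespace DcC

/-! Conventions. `N` is the finite set of devices. A cellular rate matrix `gs` has entries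
`gs k n`, the rate on the cellular link of device `k` for the flow of device `n`
(`g_{k,s}^n`). A local-area rate matrix has entries `gw k n`, the virtual rate from `k` to `n`
for the flow of `k` (`g_{k,n}^k`), for `n ≠ k`. The queues `eta n k` and `Q n k` sit at device
`n` and belong to the flow of `k`, for `n ≠ k`; diagonal entries of `gw`, `eta`, `Q` are never
used. Unicast and broadcast are treated through a space `𝒜` of local-area actions with a map
`rate : 𝒜 → N → N → ℝ` to the resulting link rates. -/

/-- The rates over the cellular link of `k` are nonnegative, and the rate that the link has to
carry, which is the maximum over the flows (all devices want the same content), is one of the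
feasible rates `Γ` of that link. -/
def CellularFeasible {N : Type*} [Fintype N] (Γ : Set ℝ) (k : N) (v : N → ℝ) : Prop :=
  (∀ n, 0 ≤ v n) ∧ Finset.univ.sup' ⟨k, Finset.mem_univ k⟩ v ∈ Γ

/-- In unicast, a local-area action is the matrix of link rates itself. -/
def unicastRate {N : Type*} (g : N → N → ℝ) : N → N → ℝ := g

/-- In broadcast, an action gives the rates `f n J` from `n` to the sets `J ∈ ℋ` of receivers,
and the link rate is `g_{k,n}^k = ∑_{J ∈ ℋ, k ∈ J, n ∉ J} f_{n,J}`. -/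
def broadcastRate {N : Type*} [DecidableEq N] (ℋ : Finset (Finset N)) (f : N → Finset N → ℝ) :
    N → N → ℝ :=
  fun k n => ∑ J ∈ ℋ with k ∈ J ∧ n ∉ J, f n J

/-- Strong stability: the expected sizes are finite, and their time averages are bounded. -/
def StronglyStable {Ω : Type*} [MeasurableSpace Ω] (μ : Measure Ω) (X : ℕ → Ω → ℝ) : Prop :=
  (∀ t, Integrable (X t) μ) ∧
    ∃ B : ℝ, ∀ T : ℕ, 1 ≤ T → (1 / (T : ℝ)) * ∑ t ∈ Finset.range T, ∫ ω, |X t ω| ∂μ ≤ B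

/-- The channel states (cellular, local-area) are independent over the slots, with law `P`. -/
structure IsIIDChannel {Ω 𝒮 : Type*} [MeasurableSpace Ω] [MeasurableSpace 𝒮]
    (P : Measure 𝒮) (μ : Measure Ω) (C : ℕ → Ω → 𝒮) : Prop where
  measurable : ∀ t, Measurable (C t)
  law : ∀ t, μ.map (C t) = P
  indep : iIndepFun C μ

section Network

variable {N : Type*} [Fintype N] [DecidableEq N]
  {𝒞 : Type u} [MeasurableSpace 𝒞] {𝒲 : Type v} [MeasurableSpace 𝒲]
  {𝒜 : Type*} [MeasurableSpace 𝒜]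

/-- Standing assumptions on the links. -/
structure LinkRegularity [Zero 𝒜] (P : Measure (𝒞 × 𝒲)) (Γc : 𝒞 → N → Set ℝ)
    (Γw : 𝒲 → Set 𝒜) (rate : 𝒜 → N → N → ℝ) : Prop where
  /-- the sets of feasible rates depend measurably on the channel state -/
  measurable_cellular : ∀ k, MeasurableSet {p : 𝒞 × ℝ | p.2 ∈ Γc p.1 k}
  measurable_local : MeasurableSet {p : 𝒲 × 𝒜 | p.2 ∈ Γw p.1}
  /-- local-area rates are nonnegative, and the local area may stay silent -/
  rate_nonneg : ∀ w, ∀ a ∈ Γw w, ∀ k n, n ≠ k → 0 ≤ rate a k n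
  silent : ∀ w, (0 : 𝒜) ∈ Γw w
  /-- the largest feasible rates have a finite second moment -/
  second_moment : ∃ b : 𝒞 × 𝒲 → ℝ, MemLp b 2 P ∧
    (∀ s k, ∀ r ∈ Γc s.1 k, r ≤ b s) ∧ (∀ s, ∀ a ∈ Γw s.2, ∀ k n, n ≠ k → rate a k n ≤ b s)
  /-- every device is connected to the source: its cellular link can be used with a positive
  mean rate -/
  connected : ∀ k, ∃ r : 𝒞 → ℝ, Measurable r ∧
    (∀ᵐ s ∂P, r s.1 ∈ Γc s.1 k ∧ 0 ≤ r s.1) ∧ 0 < ∫ s, r s.1 ∂P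

/-- A scheduling policy (any choice of feasible rates, not necessarily causal) that keeps the
network stable for an arrival process of mean rates `A`. -/
structure IsStabilizingPolicy (P : Measure (𝒞 × 𝒲)) (Γc : 𝒞 → N → Set ℝ) (Γw : 𝒲 → Set 𝒜)
    (rate : 𝒜 → N → N → ℝ) (A : N → ℝ)
    {Ω : Type*} [MeasurableSpace Ω] (μ : Measure Ω) (C : ℕ → Ω → 𝒞 × 𝒲)
    (y : ℕ → N → Ω → ℝ) (gs : ℕ → N → N → Ω → ℝ) (a : ℕ → Ω → 𝒜)
    (lam : ℕ → N → Ω → ℝ) (eta : ℕ → N → N → Ω → ℝ) : Prop where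
  channel : IsIIDChannel P μ C
  arrival_integrable : ∀ t k, Integrable (y t k) μ
  arrival_nonneg : ∀ᵐ ω ∂μ, ∀ t k, 0 ≤ y t k ω
  arrival_mean : ∀ t k, ∫ ω, y t k ω ∂μ = A k
  measurable_cellular : ∀ t k n, Measurable (gs t k n)
  measurable_local : ∀ t, Measurable (a t)
  feasible_cellular : ∀ᵐ ω ∂μ, ∀ t k,
    CellularFeasible (Γc (C t ω).1 k) k (fun n => gs t k n ω)
  feasible_local : ∀ᵐ ω ∂μ, ∀ t, a t ω ∈ Γw (C t ω).2
  initial : ∀ᵐ ω ∂μ, (∀ k, 0 ≤ lam 0 k ω) ∧ ∀ n k, n ≠ k → 0 ≤ eta 0 n k ω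
  lam_step : ∀ᵐ ω ∂μ, ∀ t k, lam (t + 1) k ω =
    max (lam t k ω - gs t k k ω - ∑ n ∈ Finset.univ.erase k, rate (a t ω) k n) 0 + y t k ω
  eta_step : ∀ᵐ ω ∂μ, ∀ t n k, n ≠ k → eta (t + 1) n k ω =
    max (eta t n k ω - gs t n k ω) 0 + rate (a t ω) k n
  lam_stable : ∀ k, StronglyStable μ (fun t => lam t k)
  eta_stable : ∀ n k, n ≠ k → StronglyStable μ (fun t => eta t n k)

/-- The stability region of the cellular and local-area links: all vectors of mean arrival rates
for which some scheduling policy keeps the network stable. -/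
def stabilityRegion (P : Measure (𝒞 × 𝒲)) (Γc : 𝒞 → N → Set ℝ) (Γw : 𝒲 → Set 𝒜)
    (rate : 𝒜 → N → N → ℝ) : Set (N → ℝ) :=
  {A | ∃ (Ω : Type (max u v)) (_ : MeasurableSpace Ω) (μ : Measure Ω) (_ : IsProbabilityMeasure μ)
    (C : ℕ → Ω → 𝒞 × 𝒲) (y : ℕ → N → Ω → ℝ) (gs : ℕ → N → N → Ω → ℝ) (a : ℕ → Ω → 𝒜)
    (lam : ℕ → N → Ω → ℝ) (eta : ℕ → N → N → Ω → ℝ),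
    IsStabilizingPolicy P Γc Γw rate A μ C y gs a lam eta}

/-- Objective of the cellular link scheduler at device `k`. -/
def cellularObjective (lam : N → ℝ) (eta Q : N → N → ℝ) (k : N) (v : N → ℝ) : ℝ :=
  lam k * v k + ∑ n ∈ Finset.univ.erase k, (eta k n - Q k n) * v n

/-- Objective of the local-area link scheduler, in terms of the link rates `g`. -/
def localObjective (lam : N → ℝ) (eta Q : N → N → ℝ) (g : N → N → ℝ) : ℝ :=
  ∑ k, ∑ n ∈ Finset.univ.erase k, (lam k - eta n k + Q n k) * g k n

/-- A network with queues `lam`, `eta`, `Q` operated by the two schedulers of DcC, with arrivals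
`y`. `ℱ t` is the information available when slot `t` begins. The real flows are
`x_{n,k} = g_{n,s}^k - β` and `h_{n,k} = g_{k,n}^k`. -/
structure IsDcCNetwork (P : Measure (𝒞 × 𝒲)) (Γc : 𝒞 → N → Set ℝ) (Γw : 𝒲 → Set 𝒜)
    (rate : 𝒜 → N → N → ℝ) (β : ℝ)
    {Ω : Type*} {mΩ : MeasurableSpace Ω} (μ : Measure Ω) (ℱ : Filtration ℕ mΩ)
    (C : ℕ → Ω → 𝒞 × 𝒲) (y : ℕ → N → Ω → ℝ)
    (gs : ℕ → N → N → Ω → ℝ) (a : ℕ → Ω → 𝒜)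
    (lam : ℕ → N → Ω → ℝ) (eta Q : ℕ → N → N → Ω → ℝ) : Prop where
  channel : IsIIDChannel P μ C
  /-- the channel state of slot `t` is independent of what happened before -/
  channel_indep : ∀ t, Indep (MeasurableSpace.comap (C t) inferInstance) (ℱ t) μ
  lam_adapted : ∀ t k, Measurable[ℱ t] (lam t k)
  eta_adapted : ∀ t n k, n ≠ k → Measurable[ℱ t] (eta t n k)
  Q_adapted : ∀ t n k, n ≠ k → Measurable[ℱ t] (Q t n k)
  lam_initial : ∀ k, MemLp (lam 0 k) 2 μ
  eta_initial : ∀ n k, n ≠ k → MemLp (eta 0 n k) 2 μ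
  Q_initial : ∀ n k, n ≠ k → MemLp (Q 0 n k) 2 μ
  lam_nonneg : ∀ᵐ ω ∂μ, ∀ t k, 0 ≤ lam t k ω
  eta_nonneg : ∀ᵐ ω ∂μ, ∀ t n k, n ≠ k → 0 ≤ eta t n k ω
  Q_nonneg : ∀ᵐ ω ∂μ, ∀ t n k, n ≠ k → 0 ≤ Q t n k ω
  cellular_feasible : ∀ᵐ ω ∂μ, ∀ t k,
    CellularFeasible (Γc (C t ω).1 k) k (fun n => gs t k n ω)
  cellular_max : ∀ᵐ ω ∂μ, ∀ t k,
    IsMaxOn (cellularObjective (fun i => lam t i ω) (fun i j => eta t i j ω)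
        (fun i j => Q t i j ω) k)
      {v | CellularFeasible (Γc (C t ω).1 k) k v} (fun n => gs t k n ω)
  local_feasible : ∀ᵐ ω ∂μ, ∀ t, a t ω ∈ Γw (C t ω).2
  local_max : ∀ᵐ ω ∂μ, ∀ t,
    IsMaxOn (fun α => localObjective (fun i => lam t i ω) (fun i j => eta t i j ω)
        (fun i j => Q t i j ω) (rate α))
      (Γw (C t ω).2) (a t ω)
  lam_step : ∀ᵐ ω ∂μ, ∀ t k, lam (t + 1) k ω ≤
    max (lam t k ω - gs t k k ω - ∑ n ∈ Finset.univ.erase k, rate (a t ω) k n) 0 + y t k ω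
  eta_step : ∀ᵐ ω ∂μ, ∀ t n k, n ≠ k → eta (t + 1) n k ω ≤
    max (eta t n k ω - gs t n k ω) 0 + rate (a t ω) k n
  /-- Since `x_{n,k} = g_{n,s}^k - β` may be negative while a queue is not, the queue is bounded
  by the positive part of `max (Q - h) 0 + x`. -/
  Q_step : ∀ᵐ ω ∂μ, ∀ t n k, n ≠ k → Q (t + 1) n k ω ≤
    max (max (Q t n k ω - rate (a t ω) k n) 0 + (gs t n k ω - β)) 0

end Network

/-- Exogenous arrivals: in every slot independent of the past, with the same distribution over
the slots, nonnegative, with a finite second moment and mean rates `A`. -/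
structure ExogenousArrivals {N Ω : Type*} {mΩ : MeasurableSpace Ω} (μ : Measure Ω)
    (ℱ : Filtration ℕ mΩ) (A : N → ℝ) (y : ℕ → N → Ω → ℝ) : Prop where
  indep : ∀ t k, Indep (MeasurableSpace.comap (y t k) inferInstance) (ℱ t) μ
  ident : ∀ t k, IdentDistrib (y t k) (y 0 k) μ μ
  nonneg : ∀ᵐ ω ∂μ, ∀ t k, 0 ≤ y t k ω
  second_moment : ∀ t k, MemLp (y t k) 2 μ
  mean : ∀ t k, ∫ ω, y t k ω ∂μ = A k

/-- Rate control of DcC: `y_k(t)` maximizes `M U_k(z) - λ_k(t) z` over the rates `z ≤ R_k` in the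
domain `D_k` of `U_k`. -/
def RateControlled {N Ω : Type*} [MeasurableSpace Ω] (μ : Measure Ω) (M : ℝ) (U : N → ℝ → ℝ)
    (D : N → Set ℝ) (R : N → ℝ) (lam y : ℕ → N → Ω → ℝ) : Prop :=
  ∀ᵐ ω ∂μ, ∀ t k, y t k ω ∈ D k ∩ Set.Iic (R k) ∧
    IsMaxOn (fun z => M * U k z - lam t k ω * z) (D k ∩ Set.Iic (R k)) (y t k ω)

/-- All virtual and real queues are stable, and so is their total size. -/
def NetworkStable {N Ω : Type*} [Fintype N] [DecidableEq N] [MeasurableSpace Ω] (μ : Measure Ω)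
    (lam : ℕ → N → Ω → ℝ) (eta Q : ℕ → N → N → Ω → ℝ) : Prop :=
  (∀ k, StronglyStable μ (fun t => lam t k)) ∧
  (∀ n k, n ≠ k → StronglyStable μ (fun t => eta t n k)) ∧
  (∀ n k, n ≠ k → StronglyStable μ (fun t => Q t n k)) ∧
  StronglyStable μ (fun t ω => ∑ k, lam t k ω +
    ∑ k, ∑ n ∈ Finset.univ.erase k, (eta t n k ω + Q t n k ω))

end DcC

/-! Lyapunov drift: DcC is compared with a stationary randomized policy through the sum of the
squares of all queues. Apart from squares of rates and arrivals, half the change of this sum in one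
slot is at most `∑ lam k * y k`, minus `β` times the real queues, minus `totalObjective` of the
chosen rates (`sum_sq_le`). This objective is linear in the rates, and the DcC schedulers maximize
it over the feasible rates, hence also against the closed convex hull
(`IsDcCNetwork.totalObjective_le`). So DcC does at least as well as any selection `G (C t)` of these
hulls. The queues depend on the past only and `C t` is independent of it, so in expectation `G (C
t)` may be replaced by its mean (`integral_totalObjective`). It remains to find mean rates that give
every queue a negative drift.

These come from `LinkRegularity.exists_slack`. In each slot, a stabilizing policy, causal or not,
has mean rates dominated by a point of the convex set `meanSet`: condition on the channel state.
Averaging these points up to a time `T` at which all mean queue sizes are at most `ε * T` balances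
flows up to `ε`. The room around `A` in the stability region pays for mixing in a little of a purely
cellular policy, which makes the balance strict. The real queues need a reverse inequality: the
cellular rate for another device's flow must stay below the local-area rate plus `β`. Scaling these
cellular rates down achieves both.

Both kinds of arrivals enter only through `ModerateArrivals`. Neither the DcC rates nor the
controlled arrivals are assumed measurable, so they are bounded pointwise by integrable functions
before expectations are taken. -/

namespace DcC

/-! ### Mean values of selections -/

section MeanSet

variable {S : Type*} [MeasurableSpace S] {E : Type*} [NormedAddCommGroup E] [NormedSpace ℝ E]

/-- The mean values of the integrable selections of the closed convex hulls of the sets `F s`. -/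
def meanSet (P : Measure S) (F : S → Set E) : Set E :=
  {x | ∃ G : S → E, Integrable G P ∧ (∀ᵐ s ∂P, G s ∈ closure (convexHull ℝ (F s))) ∧
    ∫ s, G s ∂P = x}

theorem le_of_mem_closure_convexHull {K : Set E} (ℓ : E →L[ℝ] ℝ) {c : ℝ}
    (h : ∀ x ∈ K, ℓ x ≤ c) {x : E} (hx : x ∈ closure (convexHull ℝ K)) : ℓ x ≤ c := by
  have hsub : closure (convexHull ℝ K) ⊆ {x | ℓ x ≤ c} :=
    closure_minimal (convexHull_min h (convex_halfSpace_le ℓ.toLinearMap.isLinear c))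
      (isClosed_le ℓ.continuous continuous_const)
  exact hsub hx

theorem map_mem_closure_convexHull {K : Set E} (T : E →L[ℝ] E) (h : ∀ x ∈ K, T x ∈ K)
    {x : E} (hx : x ∈ closure (convexHull ℝ K)) : T x ∈ closure (convexHull ℝ K) := by
  have hsub : closure (convexHull ℝ K) ⊆ T ⁻¹' closure (convexHull ℝ K) :=
    closure_minimal (convexHull_min
      (fun x hx => subset_closure (subset_convexHull ℝ K (h x hx)))
      ((convex_convexHull ℝ K).closure.linear_preimage T.toLinearMap))
      (isClosed_closure.preimage T.continuous)
  exact hsub hx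

theorem convex_meanSet (P : Measure S) (F : S → Set E) : Convex ℝ (meanSet P F) := by
  rintro _ ⟨G, hG, hGF, rfl⟩ _ ⟨H, hH, hHF, rfl⟩ a b ha hb hab
  refine ⟨fun s => a • G s + b • H s, (hG.smul a).add (hH.smul b), ?_, ?_⟩
  · filter_upwards [hGF, hHF] with s h1 h2
    exact (convex_convexHull ℝ (F s)).closure h1 h2 ha hb hab
  · rw [← integral_smul, ← integral_smul]
    exact integral_add (hG.smul a) (hH.smul b)

variable [CompleteSpace E]

theorem map_mem_meanSet {P : Measure S} {F : S → Set E} (T : E →L[ℝ] E)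
    (h : ∀ s, ∀ x ∈ F s, T x ∈ F s) {x : E} (hx : x ∈ meanSet P F) : T x ∈ meanSet P F := by
  obtain ⟨G, hG, hGF, rfl⟩ := hx
  refine ⟨fun s => T (G s), T.integrable_comp hG, ?_, T.integral_comp_comm hG⟩
  filter_upwards [hGF] with s hs
  exact map_mem_closure_convexHull T (h s) hs

theorem le_of_mem_meanSet {P : Measure S} [IsProbabilityMeasure P] {F : S → Set E}
    (ℓ : E →L[ℝ] ℝ) {c : ℝ} (h : ∀ s, ∀ x ∈ F s, ℓ x ≤ c) {x : E} (hx : x ∈ meanSet P F) :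
    ℓ x ≤ c := by
  obtain ⟨G, hG, hGF, rfl⟩ := hx
  rw [← ℓ.integral_comp_comm hG]
  calc ∫ s, ℓ (G s) ∂P ≤ ∫ _, c ∂P := by
        refine integral_mono_ae (ℓ.integrable_comp hG) (integrable_const c) ?_
        filter_upwards [hGF] with s hs
        exact le_of_mem_closure_convexHull ℓ (h s) hs
    _ = c := by simp

/-- The mean of a random choice from the sets `F (C ω)`, which may depend on more than `C`, is the
mean of a selection of the closed convex hulls. -/
theorem integral_mem_meanSet {Ω : Type*} [MeasurableSpace Ω] {μ : Measure Ω}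
    [IsProbabilityMeasure μ] {V : Type*} [MeasurableSpace V] [StandardBorelSpace V] [Nonempty V]
    {C : Ω → S} (hC : Measurable C) {Y : Ω → V} (hY : Measurable Y)
    {Z : Set (S × V)} (hZ : MeasurableSet Z) (hYZ : ∀ᵐ ω ∂μ, (C ω, Y ω) ∈ Z)
    {F : S → Set E} {f : V → E} (hf : StronglyMeasurable f) (hfF : ∀ s v, (s, v) ∈ Z → f v ∈ F s)
    (hi : Integrable (fun ω => f (Y ω)) μ) :
    ∫ ω, f (Y ω) ∂μ ∈ meanSet (μ.map C) F := by
  have hmap := compProd_map_condDistrib (X := C) (μ := μ) (mβ := inferInstance) hY.aemeasurable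
  have : IsProbabilityMeasure (μ.map C) := Measure.isProbabilityMeasure_map hC.aemeasurable
  have hCY : Measurable (fun ω => (C ω, Y ω)) := hC.prodMk hY
  have hfs : StronglyMeasurable (fun p : S × V => f p.2) := hf.comp_measurable measurable_snd
  have hint : Integrable (fun p : S × V => f p.2) (μ.map C ⊗ₘ condDistrib Y C μ) := by
    rw [hmap]
    exact (integrable_map_measure hfs.aestronglyMeasurable hCY.aemeasurable).2 hi
  have hint' := (Measure.integrable_compProd_iff hfs.aestronglyMeasurable).1 hint
  have hae : ∀ᵐ p ∂(μ.map C ⊗ₘ condDistrib Y C μ), p ∈ Z := by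
    rw [hmap]
    exact (ae_map_iff hCY.aemeasurable hZ).2 hYZ
  -- The selection is the conditional mean given `C`. The conditional law of `Y` sits on the section
  -- of `Z`, so its mean lies in the closed convex hull; no measurable selection theorem is needed.
  refine ⟨fun s => ∫ v, f v ∂(condDistrib Y C μ s), ?_, ?_, ?_⟩
  · exact hint.integral_compProd
  · filter_upwards [Measure.ae_ae_of_ae_compProd hae, hint'.1] with s hs hs'
    refine Convex.integral_mem (convex_convexHull ℝ (F s)).closure isClosed_closure ?_ hs'
    filter_upwards [hs] with v hv
    exact subset_closure (subset_convexHull ℝ _ (hfF s v hv))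
  · rw [← Measure.integral_compProd hint, hmap,
      integral_map hCY.aemeasurable hfs.aestronglyMeasurable]

end MeanSet

/-! ### Integrals of products of independent factors and of finite sums -/

theorem Indep.integrable_mul_comp {Ω S : Type*} [MeasurableSpace S]
    {m : MeasurableSpace Ω} {mΩ : MeasurableSpace Ω} {μ : Measure Ω} [IsFiniteMeasure μ]
    {P : Measure S} {C : Ω → S} (hC : MeasurePreserving C μ P)
    (hind : Indep (MeasurableSpace.comap C inferInstance) m μ)
    {X : Ω → ℝ} (hX : Measurable[m] X) (hXi : Integrable X μ)
    {g : S → ℝ} (hg : Integrable g P) :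
    Integrable (fun ω => X ω * g (C ω)) μ ∧
      ∫ ω, X ω * g (C ω) ∂μ = ∫ ω, X ω * (∫ s, g s ∂P) ∂μ := by
  have h1 : IndepFun X C μ := by
    rw [IndepFun_iff_Indep]
    exact indep_of_indep_of_le_left hind.symm hX.comap_le
  have hgC : Integrable (g ∘ C) μ := (hC.integrable_comp hg.aestronglyMeasurable).2 hg
  have h2 : IndepFun X (g ∘ C) μ := by
    have := h1.comp₀ (φ := id) (ψ := g) hXi.aemeasurable hC.aemeasurable aemeasurable_id
      (by rw [hC.map_eq]; exact hg.aemeasurable)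
    simpa using this
  refine ⟨h2.integrable_mul hXi hgC, ?_⟩
  have := h2.integral_fun_mul_eq_mul_integral hXi.aestronglyMeasurable hgC.aestronglyMeasurable
  simp only [Function.comp_apply] at this
  rw [this, integral_mul_const, ← hC.map_eq, integral_map hC.aemeasurable]
  rw [hC.map_eq]; exact hg.aestronglyMeasurable

theorem integrable_sum_and_integral_eq {Ω ι : Type*} [MeasurableSpace Ω] {μ : Measure Ω}
    {s : Finset ι} {f g : ι → Ω → ℝ}
    (h : ∀ i ∈ s, Integrable (f i) μ ∧ ∫ ω, f i ω ∂μ = ∫ ω, g i ω ∂μ)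
    (hg : ∀ i ∈ s, Integrable (g i) μ) :
    Integrable (fun ω => ∑ i ∈ s, f i ω) μ ∧
      ∫ ω, ∑ i ∈ s, f i ω ∂μ = ∫ ω, ∑ i ∈ s, g i ω ∂μ := by
  refine ⟨integrable_finsetSum _ fun i hi => (h i hi).1, ?_⟩
  rw [integral_finsetSum _ fun i hi => (h i hi).1, integral_finsetSum _ hg]
  exact Finset.sum_congr rfl fun i hi => (h i hi).2

/-! ### Elementary estimates -/

/-- If the queue is not emptied, expand the square and drop `-2 * s * y`; if it is, `X' ≤ y` and `(X
- s) ^ 2 ≥ 0` does the rest. -/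
theorem sq_le_of_le_max_sub_add {X X' s y : ℝ} (hX : 0 ≤ X) (hX' : 0 ≤ X') (hs : 0 ≤ s)
    (hy : 0 ≤ y) (h : X' ≤ max (X - s) 0 + y) :
    X' ^ 2 ≤ X ^ 2 + s ^ 2 + y ^ 2 + 2 * (X * (y - s)) := by
  rcases max_cases (X - s) 0 with ⟨h1, h2⟩ | ⟨h1, h2⟩ <;> rw [h1] at h
  · nlinarith [mul_nonneg hs hy]
  · nlinarith [mul_nonneg hX hy, sq_nonneg (X - s)]

/-- The outer positive part can only shrink the square. Since `x` may be negative, the cross term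
`-2 * r * x` cannot be dropped; it costs the factors 2. -/
theorem sq_le_of_le_max_max_sub_add {X X' r x : ℝ} (hX : 0 ≤ X) (hX' : 0 ≤ X')
    (h : X' ≤ max (max (X - r) 0 + x) 0) :
    X' ^ 2 ≤ X ^ 2 + 2 * r ^ 2 + 2 * x ^ 2 + 2 * (X * (x - r)) := by
  have h0 : X' ^ 2 ≤ (max (X - r) 0 + x) ^ 2 := by
    rcases max_cases (max (X - r) 0 + x) 0 with ⟨h1, h2⟩ | ⟨h1, h2⟩ <;> rw [h1] at h
    · nlinarith
    · have : X' = 0 := le_antisymm h hX'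
      rw [this, zero_pow two_ne_zero]; positivity
  refine h0.trans ?_
  rcases max_cases (X - r) 0 with ⟨h1, h2⟩ | ⟨h1, h2⟩ <;> rw [h1]
  · nlinarith [sq_nonneg (x + r)]
  · nlinarith [sq_nonneg (X - r), sq_nonneg (X + x), sq_nonneg (X - r + x), sq_nonneg (x + r)]

/-- Stability bounds only time averages, so sublinear smallness is claimed at one time only. If `S T
> ε * T` always held, the second half of `2 * (m + 1)` terms would already sum to at least `ε * (m +
1) ^ 2`, too much for large `m`. -/
theorem exists_le_mul_of_sum_le {S : ℕ → ℝ} (hS : ∀ t, 0 ≤ S t) {B : ℝ}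
    (h : ∀ T : ℕ, 1 ≤ T → ∑ t ∈ Finset.range T, S t ≤ B * T) {ε : ℝ} (hε : 0 < ε) :
    ∃ T : ℕ, 1 ≤ T ∧ S T ≤ ε * T := by
  by_contra! hcon
  obtain ⟨m, hm⟩ := exists_nat_gt (2 * B / ε)
  rw [div_lt_iff₀ hε] at hm
  have hm' : 2 * B < ε * (m + 1) := by nlinarith
  have h1 := h ((m + 1) + (m + 1)) (by omega)
  rw [Finset.sum_range_add] at h1
  have h2 : 0 ≤ ∑ t ∈ Finset.range (m + 1), S t := Finset.sum_nonneg fun t _ => hS t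
  have h3 : ∑ t ∈ Finset.range (m + 1), ε * (m + 1) ≤ ∑ t ∈ Finset.range (m + 1), S (m + 1 + t) := by
    refine Finset.sum_le_sum fun t _ => ?_
    refine le_trans ?_ (hcon (m + 1 + t) (by omega)).le
    push_cast
    have : (0 : ℝ) ≤ t := by positivity
    nlinarith
  rw [Finset.sum_const, Finset.card_range, nsmul_eq_mul] at h3
  push_cast at h1 h3
  nlinarith [(by positivity : (0 : ℝ) < (m : ℝ) + 1)]

/-- Rate control admits little traffic into a long queue. -/
theorem exists_mul_le_of_strictConcaveOn {U : ℝ → ℝ} {D : Set ℝ}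
    (hD : D = Set.Ici 0 ∨ D = Set.Ioi 0) (hU : StrictConcaveOn ℝ D U) {M : ℝ} (hM : 0 < M)
    (R : ℝ) {ε : ℝ} (hε : 0 < ε) :
    ∃ K : ℝ, 0 ≤ K ∧ ∀ l y : ℝ, 0 ≤ l → y ∈ D ∩ Set.Iic R →
      IsMaxOn (fun z => M * U z - l * z) (D ∩ Set.Iic R) y → l * y ≤ ε * l + K := by
  have hpos : ∀ z, 0 < z → z ∈ D := by
    rcases hD with rfl | rfl
    · exact fun z hz => le_of_lt hz
    · exact fun z hz => hz
  -- A chord slope replaces a derivative, and starts at `ε / 2` because 0 may lie outside the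
  -- domain. For `y > ε`, maximality against `ε` and concavity give `l * (y - ε) ≤ M * c * (y - ε)`,
  -- bounded since `y ≤ R`.
  set c := (U ε - U (ε / 2)) / (ε - ε / 2)
  refine ⟨M * |c| * |R|, by positivity, fun l y hl hy hmax => ?_⟩
  have hK : 0 ≤ M * |c| * |R| := by positivity
  rcases le_or_gt y ε with hle | hgt
  · nlinarith [mul_le_mul_of_nonneg_left hle hl]
  · have hyR : y ≤ R := hy.2
    have h1 := hmax ⟨hpos ε hε, (hgt.le.trans hyR : ε ≤ R)⟩
    change M * U ε - l * ε ≤ M * U y - l * y at h1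
    have h2 := hU.concaveOn.slope_anti_adjacent (hpos (ε / 2) (by linarith)) hy.1
      (by linarith : ε / 2 < ε) hgt
    rw [div_le_iff₀ (by linarith)] at h2
    change U y - U ε ≤ c * (y - ε) at h2
    have h3 : l * (y - ε) ≤ M * (c * (y - ε)) := by nlinarith
    have h4 : c * (y - ε) ≤ |c| * |R| := by
      have : y - ε ≤ |R| := by linarith [le_abs_self R]
      calc c * (y - ε) ≤ |c| * (y - ε) :=
            mul_le_mul_of_nonneg_right (le_abs_self c) (by linarith)
        _ ≤ |c| * |R| := mul_le_mul_of_nonneg_left this (abs_nonneg c)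
    nlinarith [mul_le_mul_of_nonneg_left h4 hM.le]

/-! ### Mean rates of scheduling policies -/

theorem exists_sum_range_le_mul {ι : Type*} {s : Finset ι} {X : ι → ℕ → ℝ}
    (h : ∀ i ∈ s, ∃ B : ℝ, ∀ T : ℕ, 1 ≤ T → ∑ t ∈ Finset.range T, X i t ≤ B * T) :
    ∃ B : ℝ, ∀ T : ℕ, 1 ≤ T → ∑ t ∈ Finset.range T, ∑ i ∈ s, X i t ≤ B * T := by
  choose! B hB using h
  refine ⟨∑ i ∈ s, B i, fun T hT => ?_⟩
  rw [Finset.sum_comm, Finset.sum_mul]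
  exact Finset.sum_le_sum fun i hi => hB i hi T hT

theorem StronglyStable.exists_sum_le_mul {Ω : Type*} [MeasurableSpace Ω] {μ : Measure Ω}
    {X : ℕ → Ω → ℝ} (h : StronglyStable μ X) :
    ∃ B : ℝ, ∀ T : ℕ, 1 ≤ T → ∑ t ∈ Finset.range T, ∫ ω, |X t ω| ∂μ ≤ B * T := by
  obtain ⟨-, B, hB⟩ := h
  refine ⟨B, fun T hT => ?_⟩
  have hT' : (0 : ℝ) < T := by exact_mod_cast hT
  have := hB T hT
  rwa [one_div, inv_mul_le_iff₀ hT', mul_comm] at this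

section Network

variable {N : Type*} [DecidableEq N]

/-- The local-area rate matrix with zero diagonal. -/
def offDiag (g : N → N → ℝ) : N → N → ℝ := fun k n => if n = k then 0 else g k n

theorem measurable_offDiag : Measurable (offDiag : (N → N → ℝ) → N → N → ℝ) := by
  refine measurable_pi_lambda _ fun k => measurable_pi_lambda _ fun n => ?_
  unfold offDiag
  split_ifs <;> fun_prop

variable [Fintype N]

/-- The cellular rate matrix in which every link carries its own flow at the largest rate. -/
def boostOwn (v : N → N → ℝ) : N → N → ℝ :=
  fun k n => if n = k then Finset.univ.sup' ⟨k, Finset.mem_univ k⟩ (v k) else v k n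

theorem le_boostOwn (v : N → N → ℝ) (k n : N) : v k n ≤ boostOwn v k n := by
  unfold boostOwn
  split_ifs
  · exact Finset.le_sup' (v k) (Finset.mem_univ n)
  · exact le_rfl

theorem measurable_boostOwn : Measurable (boostOwn : (N → N → ℝ) → N → N → ℝ) := by
  refine measurable_pi_lambda _ fun k => measurable_pi_lambda _ fun n => ?_
  unfold boostOwn
  split_ifs
  · have := Finset.measurable_sup' (⟨k, Finset.mem_univ k⟩ : (Finset.univ : Finset N).Nonempty)
      (f := fun n (v : N → N → ℝ) => v k n) (fun n _ => by fun_prop)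
    convert this using 1
    ext v
    exact (Finset.sup'_apply (C := fun _ : N → N → ℝ => ℝ) ⟨k, Finset.mem_univ k⟩
      (fun n v => v k n) v).symm
  · fun_prop

/-- The sum of the objectives of the cellular and the local-area schedulers. -/
noncomputable def totalObjective (lam : N → ℝ) (eta Q : N → N → ℝ) :
    ((N → N → ℝ) × (N → N → ℝ)) →L[ℝ] ℝ :=
  LinearMap.toContinuousLinearMap
    { toFun := fun x => ∑ k, cellularObjective lam eta Q k (x.1 k) + localObjective lam eta Q x.2
      map_add' := fun x z => by
        simp only [cellularObjective, localObjective, Prod.fst_add, Prod.snd_add, Pi.add_apply,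
          mul_add, Finset.sum_add_distrib]
        ring
      map_smul' := fun c x => by
        simp only [cellularObjective, localObjective, Prod.smul_fst, Prod.smul_snd, Pi.smul_apply,
          smul_eq_mul, RingHom.id_apply, mul_add, Finset.mul_sum, mul_left_comm c] }

theorem totalObjective_apply (lam : N → ℝ) (eta Q : N → N → ℝ)
    (x : (N → N → ℝ) × (N → N → ℝ)) : totalObjective lam eta Q x =
      ∑ k, cellularObjective lam eta Q k (x.1 k) + localObjective lam eta Q x.2 := rfl

theorem sum_sum_erase_comm (f : N → N → ℝ) :
    ∑ k, ∑ n ∈ Finset.univ.erase k, f k n = ∑ k, ∑ n ∈ Finset.univ.erase k, f n k := by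
  refine Finset.sum_comm' fun x y => ?_
  simp [eq_comm]

/-- The total objective, sorted by queues. -/
theorem totalObjective_eq (lam : N → ℝ) (eta Q : N → N → ℝ)
    (x : (N → N → ℝ) × (N → N → ℝ)) : totalObjective lam eta Q x =
      ∑ k, (lam k * (x.1 k k + ∑ n ∈ Finset.univ.erase k, x.2 k n) +
        ∑ n ∈ Finset.univ.erase k,
          (eta n k * (x.1 n k - x.2 k n) + Q n k * (x.2 k n - x.1 n k))) := by
  simp only [totalObjective_apply, cellularObjective, localObjective, Finset.sum_add_distrib]
  rw [sum_sum_erase_comm (fun k n => (eta k n - Q k n) * x.1 k n), add_assoc,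
    ← Finset.sum_add_distrib]
  simp only [mul_add, Finset.mul_sum, ← Finset.sum_add_distrib, add_assoc]
  simp only [Finset.sum_add_distrib, add_right_inj]
  simp only [← Finset.sum_add_distrib]
  refine Finset.sum_congr rfl fun k _ => Finset.sum_congr rfl fun n _ => by ring

variable {𝒞 : Type u} {𝒲 : Type v} {𝒜 : Type*}

/-- The feasible pairs of cellular and local-area rate matrices in which every cellular link
carries its own flow at the full rate. -/
def rateSet (Γc : 𝒞 → N → Set ℝ) (Γw : 𝒲 → Set 𝒜) (rate : 𝒜 → N → N → ℝ) (s : 𝒞 × 𝒲) :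
    Set ((N → N → ℝ) × (N → N → ℝ)) :=
  {x | (∀ k, x.1 k k ∈ Γc s.1 k ∧ ∀ n, 0 ≤ x.1 k n ∧ x.1 k n ≤ x.1 k k) ∧
    ∃ a ∈ Γw s.2, x.2 = offDiag (rate a)}

variable {Γc : 𝒞 → N → Set ℝ} {Γw : 𝒲 → Set 𝒜} {rate : 𝒜 → N → N → ℝ}

/-- Raising the own-flow rate to the maximum on the link costs no feasibility and only helps `lam`.
The maximum then sits on the diagonal, so the other flows can be scaled down without leaving the
feasible set. Zeroing the local diagonal removes entries on which no bound is assumed. -/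
theorem boostOwn_offDiag_mem_rateSet {s : 𝒞 × 𝒲} {v : N → N → ℝ}
    (hv : ∀ k, CellularFeasible (Γc s.1 k) k (v k)) {a : 𝒜} (ha : a ∈ Γw s.2) :
    (boostOwn v, offDiag (rate a)) ∈ rateSet Γc Γw rate s := by
  refine ⟨fun k => ⟨by simpa [boostOwn] using (hv k).2, fun n => ?_⟩, a, ha, rfl⟩
  refine ⟨((hv k).1 n).trans (le_boostOwn v k n), ?_⟩
  simp only [boostOwn, if_true]
  split_ifs
  · exact le_rfl
  · exact Finset.le_sup' (v k) (Finset.mem_univ n)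

theorem cellularFeasible_of_mem_rateSet {s : 𝒞 × 𝒲} {x : (N → N → ℝ) × (N → N → ℝ)}
    (hx : x ∈ rateSet Γc Γw rate s) (k : N) : CellularFeasible (Γc s.1 k) k (x.1 k) := by
  refine ⟨fun n => ((hx.1 k).2 n).1, ?_⟩
  have : Finset.univ.sup' ⟨k, Finset.mem_univ k⟩ (x.1 k) = x.1 k k :=
    le_antisymm (Finset.sup'_le _ _ fun n _ => ((hx.1 k).2 n).2)
      (Finset.le_sup' (x.1 k) (Finset.mem_univ k))
  rw [this]
  exact (hx.1 k).1

variable [MeasurableSpace 𝒞] [MeasurableSpace 𝒲] [MeasurableSpace 𝒜] {P : Measure (𝒞 × 𝒲)}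

/-- The mean rates that a scheduling policy obtains in one slot. -/
theorem LinkRegularity.exists_mem_meanSet [Zero 𝒜] [StandardBorelSpace 𝒜]
    (hreg : LinkRegularity P Γc Γw rate) (hrate : ∀ k n, Measurable fun a => rate a k n)
    {Ω : Type*} [MeasurableSpace Ω] {μ : Measure Ω} [IsProbabilityMeasure μ]
    {C : Ω → 𝒞 × 𝒲} (hC : MeasurePreserving C μ P) {gs : N → N → Ω → ℝ}
    (hgs : ∀ k n, Measurable (gs k n)) {a : Ω → 𝒜} (ha : Measurable a)
    (hfc : ∀ᵐ ω ∂μ, ∀ k, CellularFeasible (Γc (C ω).1 k) k fun n => gs k n ω)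
    (hfl : ∀ᵐ ω ∂μ, a ω ∈ Γw (C ω).2) :
    (∀ k n, Integrable (gs k n) μ) ∧ (∀ k n, n ≠ k → Integrable (fun ω => rate (a ω) k n) μ) ∧
    ∃ x ∈ meanSet P (rateSet Γc Γw rate), (∀ k n, ∫ ω, gs k n ω ∂μ ≤ x.1 k n) ∧
      ∀ k n, n ≠ k → ∫ ω, rate (a ω) k n ∂μ = x.2 k n := by
  obtain ⟨b, hb, hbc, hbl⟩ := hreg.second_moment
  have hbC : Integrable (fun ω => b (C ω)) μ :=
    (hb.comp_measurePreserving hC).integrable (by norm_num)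
  have hV : Measurable fun ω => (fun k n => gs k n ω : N → N → ℝ) :=
    measurable_pi_lambda _ fun k => measurable_pi_lambda _ fun n => hgs k n
  have hboost : ∀ k n, Integrable (fun ω => boostOwn (fun k n => gs k n ω) k n) μ := by
    intro k n
    refine hbC.mono' ?_ ?_
    · exact (((measurable_boostOwn.comp hV).eval (a := k)).eval (a := n)).aestronglyMeasurable
    · filter_upwards [hfc, hfl] with ω h1 h2
      have h3 := (boostOwn_offDiag_mem_rateSet (rate := rate) h1 h2).1 k
      rw [Real.norm_of_nonneg (h3.2 n).1]
      exact (h3.2 n).2.trans (hbc _ k _ h3.1)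
  have hgsi : ∀ k n, Integrable (gs k n) μ := by
    intro k n
    refine (hboost k n).mono' (hgs k n).aestronglyMeasurable ?_
    filter_upwards [hfc] with ω h1
    rw [Real.norm_of_nonneg ((h1 k).1 n)]
    exact le_boostOwn (fun k n => gs k n ω) k n
  have hri : ∀ k n, n ≠ k → Integrable (fun ω => rate (a ω) k n) μ := by
    intro k n hnk
    refine hbC.mono' ((hrate k n).comp ha).aestronglyMeasurable ?_
    filter_upwards [hfl] with ω h1
    rw [Real.norm_of_nonneg (hreg.rate_nonneg _ _ h1 k n hnk)]
    exact hbl _ _ h1 k n hnk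
  refine ⟨hgsi, hri, ?_⟩
  let f : (N → N → ℝ) × 𝒜 → (N → N → ℝ) × (N → N → ℝ) :=
    fun p => (boostOwn p.1, offDiag (rate p.2))
  let Y : Ω → (N → N → ℝ) × 𝒜 := fun ω => (fun k n => gs k n ω, a ω)
  have hf : Measurable f :=
    (measurable_boostOwn.comp measurable_fst).prodMk (measurable_offDiag.comp
      ((measurable_pi_lambda _ fun k => measurable_pi_lambda _ fun n => hrate k n).comp
        measurable_snd))
  -- The graph of joint feasibility. It is measurable because the link maximum is the diagonal entry
  -- of `boostOwn`.
  let Z : Set ((𝒞 × 𝒲) × ((N → N → ℝ) × 𝒜)) :=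
    {p | (∀ k, CellularFeasible (Γc p.1.1 k) k (p.2.1 k)) ∧ p.2.2 ∈ Γw p.1.2}
  have hZ : MeasurableSet Z := by
    have h1 : ∀ k, MeasurableSet {p : (𝒞 × 𝒲) × ((N → N → ℝ) × 𝒜) |
        CellularFeasible (Γc p.1.1 k) k (p.2.1 k)} := by
      intro k
      have h2 : Measurable fun p : (𝒞 × 𝒲) × ((N → N → ℝ) × 𝒜) =>
          (p.1.1, boostOwn p.2.1 k k) :=
        (measurable_fst.comp measurable_fst).prodMk (((measurable_boostOwn.comp
          (measurable_fst.comp measurable_snd)).eval (a := k)).eval (a := k))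
      have h3 := h2 (hreg.measurable_cellular k)
      have h4 : MeasurableSet {p : (𝒞 × 𝒲) × ((N → N → ℝ) × 𝒜) | ∀ n, 0 ≤ p.2.1 k n} := by
        rw [Set.ofPred_forall]
        exact MeasurableSet.iInter fun n => measurableSet_le measurable_const
          (((measurable_fst.comp measurable_snd).eval (a := k)).eval (a := n))
      convert h4.inter h3 using 1
      ext p
      simp [CellularFeasible, boostOwn]
    have h5 : MeasurableSet {p : (𝒞 × 𝒲) × ((N → N → ℝ) × 𝒜) | p.2.2 ∈ Γw p.1.2} :=
      ((measurable_snd.comp measurable_fst).prodMk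
        (measurable_snd.comp measurable_snd)) hreg.measurable_local
    have h6 := (MeasurableSet.iInter h1).inter h5
    convert h6 using 1
    ext p
    simp [Z]
  have h1i : Integrable (fun ω => boostOwn (fun k n => gs k n ω)) μ :=
    Integrable.of_eval fun k => Integrable.of_eval fun n => hboost k n
  have h2i : Integrable (fun ω => offDiag (rate (a ω))) μ := by
    refine Integrable.of_eval fun k => Integrable.of_eval fun n => ?_
    by_cases hnk : n = k
    · simp [offDiag, hnk]
    · simpa [offDiag, hnk] using hri k n hnk
  have hi : Integrable (fun ω => f (Y ω)) μ := h1i.prodMk h2i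
  have hmem := integral_mem_meanSet (C := C) (Y := Y) (F := rateSet Γc Γw rate) (Z := Z)
    hC.measurable (hV.prodMk ha) hZ (by filter_upwards [hfc, hfl] with ω h1 h2 using ⟨h1, h2⟩)
    hf.stronglyMeasurable (fun s v hv => boostOwn_offDiag_mem_rateSet hv.1 hv.2) hi
  rw [hC.map_eq] at hmem
  refine ⟨_, hmem, fun k n => ?_, fun k n hnk => ?_⟩
  · rw [fst_integral hi, eval_integral (fun k => h1i.eval k),
      eval_integral (fun n => hboost k n)]
    exact integral_mono (hgsi k n) (hboost k n) fun ω => le_boostOwn (fun k n => gs k n ω) k n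
  · rw [snd_integral hi, eval_integral (fun k => h2i.eval k),
      eval_integral (fun n => (h2i.eval k).eval n)]
    simp [offDiag, hnk]

end Network

/-! ### Slack for arrival rates in the interior of the stability region -/

section Network

variable {N : Type*} [Fintype N] [DecidableEq N]
  {𝒞 : Type u} [MeasurableSpace 𝒞] {𝒲 : Type v} [MeasurableSpace 𝒲]
  {𝒜 : Type*} {P : Measure (𝒞 × 𝒲)} {Γc : 𝒞 → N → Set ℝ} {Γw : 𝒲 → Set 𝒜}
  {rate : 𝒜 → N → N → ℝ}

/-- The rates for the flows of other devices can be reduced at will. -/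
theorem scale_mem_meanSet {x : (N → N → ℝ) × (N → N → ℝ)}
    (hx : x ∈ meanSet P (rateSet Γc Γw rate)) {θ : N → N → ℝ} (hθ : ∀ k n, 0 ≤ θ k n ∧ θ k n ≤ 1)
    (hθ' : ∀ k, θ k k = 1) :
    ((fun k n => θ k n * x.1 k n, x.2) : (N → N → ℝ) × (N → N → ℝ)) ∈
      meanSet P (rateSet Γc Γw rate) := by
  let T : ((N → N → ℝ) × (N → N → ℝ)) →L[ℝ] ((N → N → ℝ) × (N → N → ℝ)) :=
    LinearMap.toContinuousLinearMap
      { toFun := fun x => (fun k n => θ k n * x.1 k n, x.2)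
        map_add' := fun x z => by ext <;> simp [mul_add]
        map_smul' := fun c x => by ext <;> simp [mul_left_comm] }
  -- `T` fixes the diagonal, which carries the maximum of each link.
  have hT : ∀ s, ∀ z ∈ rateSet Γc Γw rate s, T z ∈ rateSet Γc Γw rate s := by
    intro s z hz
    have h3 : ∀ k, (T z).1 k k = z.1 k k := fun k => by simp [T, hθ']
    refine ⟨fun k => ⟨(h3 k).symm ▸ (hz.1 k).1, fun n => ?_⟩, hz.2⟩
    have h2 := (hz.1 k).2 n
    refine ⟨mul_nonneg (hθ k n).1 h2.1, ?_⟩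
    rw [h3]
    exact (mul_le_of_le_one_left h2.1 (hθ k n).2).trans h2.2
  exact map_mem_meanSet T hT hx

variable [MeasurableSpace 𝒜] [Zero 𝒜]

theorem IsIIDChannel.measurePreserving {Ω 𝒮 : Type*} [MeasurableSpace Ω] [MeasurableSpace 𝒮]
    {P : Measure 𝒮} {μ : Measure Ω} {C : ℕ → Ω → 𝒮} (h : IsIIDChannel P μ C) (t : ℕ) :
    MeasurePreserving (C t) μ P := ⟨h.measurable t, h.law t⟩

/-- A queue with nonnegative initial value has seen almost as much service as arrivals when it is
short. -/
theorem sum_integral_sub_le {Ω : Type*} [MeasurableSpace Ω] {μ : Measure Ω}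
    {X i o : ℕ → Ω → ℝ} (hX : ∀ t, Integrable (X t) μ) (hi : ∀ t, Integrable (i t) μ)
    (ho : ∀ t, Integrable (o t) μ) (h0 : ∀ᵐ ω ∂μ, 0 ≤ X 0 ω)
    (h : ∀ᵐ ω ∂μ, ∀ t, X t ω - o t ω + i t ω ≤ X (t + 1) ω) (T : ℕ) :
    ∑ t ∈ Finset.range T, (∫ ω, i t ω ∂μ - ∫ ω, o t ω ∂μ) ≤ ∫ ω, |X T ω| ∂μ := by
  have key : ∑ t ∈ Finset.range T, (∫ ω, i t ω ∂μ - ∫ ω, o t ω ∂μ) ≤ ∫ ω, X T ω ∂μ := by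
    induction T with
    | zero => simpa using integral_nonneg_of_ae h0
    | succ T ih =>
      rw [Finset.sum_range_succ]
      have h1 : ∫ ω, (X T ω - o T ω + i T ω) ∂μ ≤ ∫ ω, X (T + 1) ω ∂μ :=
        integral_mono_ae (((hX T).sub (ho T)).add (hi T)) (hX (T + 1))
          (by filter_upwards [h] with ω hω using hω T)
      have h2 : ∫ ω, (X T ω - o T ω + i T ω) ∂μ =
          ∫ ω, X T ω ∂μ - ∫ ω, o T ω ∂μ + ∫ ω, i T ω ∂μ := by
        rw [← integral_sub (hX T) (ho T)]
        exact integral_add ((hX T).sub (ho T)) (hi T)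
      linarith
  exact key.trans (integral_mono (hX T) (hX T).abs fun ω => le_abs_self _)

/-- Every arrival vector of the stability region is nonnegative, and almost balanced by the mean
rates of some stationary policy. -/
theorem LinkRegularity.exists_almost_balanced [StandardBorelSpace 𝒜]
    (hreg : LinkRegularity P Γc Γw rate) (hrate : ∀ k n, Measurable fun a => rate a k n)
    {A : N → ℝ} (hA : A ∈ stabilityRegion P Γc Γw rate) {ε : ℝ} (hε : 0 < ε) :
    (∀ k, 0 ≤ A k) ∧ ∃ x ∈ meanSet P (rateSet Γc Γw rate),
      (∀ k, A k - ε ≤ x.1 k k + ∑ n ∈ Finset.univ.erase k, x.2 k n) ∧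
      ∀ k n, n ≠ k → x.2 k n - ε ≤ x.1 n k := by
  obtain ⟨Ω, _, μ, _, C, y, gs, a, lam, eta, h⟩ := hA
  have hslot : ∀ t, _ := fun t => hreg.exists_mem_meanSet hrate (h.channel.measurePreserving t)
    (h.measurable_cellular t) (h.measurable_local t)
    (by filter_upwards [h.feasible_cellular] with ω hω using hω t)
    (by filter_upwards [h.feasible_local] with ω hω using hω t)
  have hgs := fun t => (hslot t).1
  have hri := fun t => (hslot t).2.1
  choose x hx hx1 hx2 using fun t => (hslot t).2.2
  refine ⟨fun k => ?_, ?_⟩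
  · rw [← h.arrival_mean 0 k]
    exact integral_nonneg_of_ae (by filter_upwards [h.arrival_nonneg] with ω hω using hω 0 k)
  -- Summing all queues yields one time `T` at which all of them are short simultaneously.
  set S : ℕ → ℝ := fun t => ∑ k, (∫ ω, |lam t k ω| ∂μ +
    ∑ n ∈ Finset.univ.erase k, ∫ ω, |eta t n k ω| ∂μ) with hS
  have habs : ∀ f : Ω → ℝ, 0 ≤ ∫ ω, |f ω| ∂μ := fun f => integral_nonneg fun ω => abs_nonneg _
  have hterm : ∀ t k, 0 ≤ ∫ ω, |lam t k ω| ∂μ +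
      ∑ n ∈ Finset.univ.erase k, ∫ ω, |eta t n k ω| ∂μ := fun t k =>
    add_nonneg (habs _) (Finset.sum_nonneg fun n _ => habs _)
  obtain ⟨B, hB⟩ : ∃ B : ℝ, ∀ T : ℕ, 1 ≤ T → ∑ t ∈ Finset.range T, S t ≤ B * T := by
    refine exists_sum_range_le_mul fun k _ => ?_
    obtain ⟨B₁, hB₁⟩ := (h.lam_stable k).exists_sum_le_mul
    obtain ⟨B₂, hB₂⟩ := exists_sum_range_le_mul (s := Finset.univ.erase k)
      (X := fun n t => ∫ ω, |eta t n k ω| ∂μ)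
      fun n hn => (h.eta_stable n k (Finset.ne_of_mem_erase hn)).exists_sum_le_mul
    refine ⟨B₁ + B₂, fun T hT => ?_⟩
    rw [Finset.sum_add_distrib, add_mul]
    exact add_le_add (hB₁ T hT) (hB₂ T hT)
  obtain ⟨T, hT, hST⟩ := exists_le_mul_of_sum_le
    (fun t => Finset.sum_nonneg fun k _ => hterm t k) hB hε
  have hT0 : (0 : ℝ) < T := by exact_mod_cast hT
  have hlamT : ∀ k, ∫ ω, |lam T k ω| ∂μ ≤ ε * T := fun k => by
    refine le_trans ?_ ((Finset.single_le_sum (fun k _ => hterm T k) (Finset.mem_univ k)).trans hST)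
    exact le_add_of_nonneg_right (Finset.sum_nonneg fun n _ => habs _)
  have hetaT : ∀ k n, n ≠ k → ∫ ω, |eta T n k ω| ∂μ ≤ ε * T := fun k n hnk => by
    refine le_trans ?_ ((Finset.single_le_sum (fun k _ => hterm T k) (Finset.mem_univ k)).trans hST)
    refine le_trans ?_ (le_add_of_nonneg_left (habs _))
    exact Finset.single_le_sum (f := fun n => ∫ ω, |eta T n k ω| ∂μ) (fun n _ => habs _)
      (Finset.mem_erase.2 ⟨hnk, Finset.mem_univ n⟩)
  -- The witness is the time average of the slot means; convexity of `meanSet` is what makes it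
  -- attainable.
  have hmem := (convex_meanSet P (rateSet Γc Γw rate)).sum_mem (t := Finset.range T)
    (w := fun _ => (T : ℝ)⁻¹) (z := x) (fun _ _ => by positivity)
    (by simp [hT0.ne']) (fun t _ => hx t)
  rw [← Finset.smul_sum] at hmem
  refine ⟨_, hmem, fun k => ?_, fun k n hnk => ?_⟩
  · have h1 := sum_integral_sub_le (X := fun t => lam t k) (i := fun t => y t k)
      (o := fun t ω => gs t k k ω + ∑ n ∈ Finset.univ.erase k, rate (a t ω) k n) (μ := μ)
      (h.lam_stable k).1 (fun t => h.arrival_integrable t k)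
      (fun t => (hgs t k k).add (integrable_finsetSum _
        fun n hn => hri t k n (Finset.ne_of_mem_erase hn)))
      (by filter_upwards [h.initial] with ω hω using hω.1 k)
      (by
        filter_upwards [h.lam_step] with ω hω t
        rw [hω t k, sub_add_eq_sub_sub]
        exact add_le_add_left (le_max_left _ _) _) T
    have h2 : ∀ t ∈ Finset.range T, A k - ((x t).1 k k + ∑ n ∈ Finset.univ.erase k, (x t).2 k n) ≤
        ∫ ω, y t k ω ∂μ - ∫ ω, (gs t k k ω + ∑ n ∈ Finset.univ.erase k, rate (a t ω) k n) ∂μ := by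
      intro t _
      rw [h.arrival_mean t k, integral_add (hgs t k k) (integrable_finsetSum _
        fun n hn => hri t k n (Finset.ne_of_mem_erase hn)), integral_finsetSum _
        fun n hn => hri t k n (Finset.ne_of_mem_erase hn)]
      rw [Finset.sum_congr rfl fun n hn => hx2 t k n (Finset.ne_of_mem_erase hn)]
      linarith [hx1 t k k]
    have h3 := (Finset.sum_le_sum h2).trans (h1.trans (hlamT k))
    rw [Finset.sum_sub_distrib, Finset.sum_const, Finset.card_range, nsmul_eq_mul,
      Finset.sum_add_distrib, Finset.sum_comm] at h3
    simp only [Prod.smul_fst, Prod.smul_snd, Prod.fst_sum, Prod.snd_sum, Pi.smul_apply,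
      Finset.sum_apply, smul_eq_mul, ← Finset.mul_sum, ← mul_add]
    rw [le_inv_mul_iff₀ hT0]
    linarith
  · have h1 := sum_integral_sub_le (X := fun t => eta t n k) (i := fun t ω => rate (a t ω) k n)
      (o := fun t => gs t n k) (μ := μ) (h.eta_stable n k hnk).1 (fun t => hri t k n hnk)
      (fun t => hgs t n k) (by filter_upwards [h.initial] with ω hω using hω.2 n k hnk)
      (by
        filter_upwards [h.eta_step] with ω hω t
        rw [hω t n k hnk]
        exact add_le_add_left (le_max_left _ _) _) T
    have h2 : ∀ t ∈ Finset.range T, (x t).2 k n - (x t).1 n k ≤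
        ∫ ω, rate (a t ω) k n ∂μ - ∫ ω, gs t n k ω ∂μ := by
      intro t _
      rw [hx2 t k n hnk]
      linarith [hx1 t n k]
    have h3 := (Finset.sum_le_sum h2).trans (h1.trans (hetaT k n hnk))
    rw [Finset.sum_sub_distrib] at h3
    simp only [Prod.smul_fst, Prod.smul_snd, Prod.fst_sum, Prod.snd_sum, Pi.smul_apply,
      Finset.sum_apply, smul_eq_mul]
    rw [le_inv_mul_iff₀ hT0, mul_sub, mul_inv_cancel_left₀ hT0.ne']
    linarith

/-- Every device uses its cellular link for all flows while the local area is silent. -/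
theorem LinkRegularity.exists_cellular_mem_meanSet [IsProbabilityMeasure P]
    (hreg : LinkRegularity P Γc Γw rate) (hrate0 : rate 0 = 0) :
    ∃ r : N → ℝ, (∀ k, 0 < r k) ∧
      ((fun k _ => r k, 0) : (N → N → ℝ) × (N → N → ℝ)) ∈ meanSet P (rateSet Γc Γw rate) := by
  choose r hr hrΓ hpos using hreg.connected
  have hri : ∀ k, Integrable (fun s : 𝒞 × 𝒲 => r k s.1) P := fun k => by
    -- A non-integrable function has integral 0 by convention, contradicting the positive mean.
    by_contra hcon
    have := hpos k
    rw [integral_undef hcon] at this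
    exact lt_irrefl _ this
  have h1 : Integrable (fun s : 𝒞 × 𝒲 => (fun k _ => r k s.1 : N → N → ℝ)) P :=
    Integrable.of_eval fun k => Integrable.of_eval fun _ => hri k
  have h2 : Integrable (fun _ : 𝒞 × 𝒲 => (0 : N → N → ℝ)) P := integrable_const 0
  refine ⟨fun k => ∫ s, r k s.1 ∂P, hpos, fun s => (fun k _ => r k s.1, 0), h1.prodMk h2, ?_, ?_⟩
  · filter_upwards [ae_all_iff.2 hrΓ] with s hs
    refine subset_closure (subset_convexHull ℝ _ ⟨fun k => ⟨(hs k).1, fun n => ⟨(hs k).2, le_rfl⟩⟩,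
      0, hreg.silent s.2, ?_⟩)
    ext k n
    simp [offDiag, hrate0]
  · refine Prod.ext ?_ ?_
    · rw [fst_integral (h1.prodMk h2)]
      ext k n
      rw [eval_integral (fun k => h1.eval k), eval_integral (fun n => hri k)]
    · rw [snd_integral (h1.prodMk h2)]
      simp

theorem LinkRegularity.local_nonneg_of_mem_meanSet [IsProbabilityMeasure P]
    (hreg : LinkRegularity P Γc Γw rate) {x : (N → N → ℝ) × (N → N → ℝ)}
    (hx : x ∈ meanSet P (rateSet Γc Γw rate)) (k n : N) : 0 ≤ x.2 k n := by
  let ℓ : ((N → N → ℝ) × (N → N → ℝ)) →L[ℝ] ℝ :=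
    LinearMap.toContinuousLinearMap
      { toFun := fun x => - x.2 k n
        map_add' := fun x z => by simp [add_comm]
        map_smul' := fun c x => by simp }
  have := le_of_mem_meanSet ℓ (c := 0) (fun s z hz => ?_) hx
  · change - x.2 k n ≤ 0 at this
    linarith
  · obtain ⟨a, ha, h2⟩ := hz.2
    change - z.2 k n ≤ 0
    rw [h2, offDiag]
    split_ifs with hnk
    · simp
    · linarith [hreg.rate_nonneg _ a ha k n hnk]

/-- For arrivals in the interior of the stability region, some stationary policy gives all queues
of the network, also the real ones, a negative drift. -/
theorem LinkRegularity.exists_slack [IsProbabilityMeasure P] [StandardBorelSpace 𝒜]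
    (hreg : LinkRegularity P Γc Γw rate) (hrate : ∀ k n, Measurable fun a => rate a k n)
    (hrate0 : rate 0 = 0) {A : N → ℝ} (hA : A ∈ interior (stabilityRegion P Γc Γw rate))
    {β : ℝ} (hβ : 0 < β) :
    (∀ k, 0 ≤ A k) ∧ ∃ σ > 0, ∃ x ∈ meanSet P (rateSet Γc Γw rate),
      (∀ k, A k + 2 * σ ≤ x.1 k k + ∑ n ∈ Finset.univ.erase k, x.2 k n) ∧
      ∀ k n, n ≠ k → x.2 k n + σ ≤ x.1 n k ∧ x.1 n k ≤ x.2 k n + β - σ := by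
  have hA0 := (hreg.exists_almost_balanced hrate (interior_subset hA) one_pos).1
  refine ⟨hA0, ?_⟩
  obtain ⟨δ, hδ, hball⟩ := Metric.mem_nhds_iff.1 (mem_interior_iff_mem_nhds.1 hA)
  set δ' := δ / 2
  have hδ' : 0 < δ' := half_pos hδ
  have hAδ : (fun k => A k + δ') ∈ stabilityRegion P Γc Γw rate := by
    refine hball ?_
    rw [Metric.mem_ball]
    refine lt_of_le_of_lt ((dist_pi_le_iff hδ'.le).2 fun k => ?_) (half_lt_self hδ)
    rw [Real.dist_eq, add_sub_cancel_left, abs_of_pos hδ']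
  obtain ⟨r, hr, hrmem⟩ := hreg.exists_cellular_mem_meanSet hrate0
  obtain ⟨r₀, hr₀, hr₀r⟩ : ∃ r₀ > 0, ∀ k, r₀ ≤ r k := by
    cases isEmpty_or_nonempty N
    · exact ⟨1, one_pos, fun k => isEmptyElim k⟩
    · obtain ⟨k, hk⟩ := Finite.exists_min r
      exact ⟨r k, hr k, hk⟩
  obtain ⟨a, ha, hAa⟩ : ∃ a ≥ 0, ∀ k, A k ≤ a :=
    ⟨∑ k, A k, Finset.sum_nonneg fun k _ => hA0 k,
      fun k => Finset.single_le_sum (fun k _ => hA0 k) (Finset.mem_univ k)⟩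
  -- Weight of the purely cellular policy, small enough that mixing costs each own flow at most `δ'
  -- / 4`.
  set p := δ' / (4 * (a + δ')) with hp
  have hp0 : 0 < p := by positivity
  have hp_mul : p * (a + δ') = δ' / 4 := by
    rw [hp]; field_simp
  have hp1 : p ≤ 1 := by
    rw [hp, div_le_one (by positivity)]; linarith
  -- Mixing adds at least `p * r₀ = 2 * τ` to every cellular rate: one `τ` covers the error `ε`, the
  -- other the slack `σ`.
  set τ := p * r₀ / 2
  have hτ : 0 < τ := by positivity
  obtain ⟨ε, hε, hε1, hε2⟩ : ∃ ε > 0, ε ≤ δ' / 4 ∧ ε ≤ τ :=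
    ⟨min (δ' / 4) τ, by positivity, min_le_left _ _, min_le_right _ _⟩
  -- For the own flows, the margin `δ'` loses `δ' / 4` to mixing and `δ' / 4` to `ε`, which leaves
  -- `2 * σ`. The bound `β / 2` makes room for `σ ≤ β - σ`.
  obtain ⟨σ, hσ, hσ1, hσ2, hσ3⟩ : ∃ σ > 0, σ ≤ δ' / 4 ∧ σ ≤ τ ∧ σ ≤ β / 2 :=
    ⟨min (δ' / 4) (min τ (β / 2)), by positivity, min_le_left _ _,
      (min_le_right _ _).trans (min_le_left _ _), (min_le_right _ _).trans (min_le_right _ _)⟩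
  obtain ⟨-, x, hx, hx1, hx2⟩ := hreg.exists_almost_balanced hrate hAδ hε
  have hz := convex_meanSet P (rateSet Γc Γw rate) hx hrmem (sub_nonneg.2 hp1) hp0.le
    (sub_add_cancel 1 p)
  set z := (1 - p) • x + p • ((fun k _ => r k, 0) : (N → N → ℝ) × (N → N → ℝ)) with hzdef
  have hz1 : ∀ k n, z.1 k n = (1 - p) * x.1 k n + p * r k := fun k n => by simp [hzdef]
  have hz2 : ∀ k n, z.2 k n = (1 - p) * x.2 k n := fun k n => by simp [hzdef]
  have hznn := hreg.local_nonneg_of_mem_meanSet hz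
  have hslack : ∀ k n, n ≠ k → z.2 k n + σ ≤ z.1 n k := fun k n hnk => by
    rw [hz1, hz2]
    have h1 : p * r₀ ≤ p * r n := mul_le_mul_of_nonneg_left (hr₀r n) hp0.le
    have h2 : (1 - p) * (x.2 k n - ε) ≤ (1 - p) * x.1 n k :=
      mul_le_mul_of_nonneg_left (hx2 k n hnk) (sub_nonneg.2 hp1)
    have h3 : p * r₀ = 2 * τ := by ring
    nlinarith [mul_pos hp0 hε]
  -- Lowers the cellular rate for another device's flow to exactly the local-area rate plus `σ`, so
  -- that `eta` and `Q` both drift down.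
  let θ : N → N → ℝ := fun n k => if k = n then 1 else (z.2 k n + σ) / z.1 n k
  have hθpos : ∀ k n, n ≠ k → 0 < z.1 n k := fun k n hnk => by
    linarith [hslack k n hnk, hznn k n]
  have hmem := scale_mem_meanSet hz (θ := θ) (fun n k => by
    simp only [θ]
    split_ifs with hkn
    · exact ⟨zero_le_one, le_rfl⟩
    · have h1 := hθpos k n (Ne.symm hkn)
      exact ⟨div_nonneg (by linarith [hznn k n]) h1.le,
        (div_le_one h1).2 (hslack k n (Ne.symm hkn))⟩) (fun k => by simp [θ])
  refine ⟨σ, hσ, _, hmem, fun k => ?_, fun k n hnk => ?_⟩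
  · simp only [θ, if_true, one_mul, hz1, hz2, ← Finset.mul_sum]
    have h1 : (1 - p) * (A k + δ' - ε) ≤
        (1 - p) * (x.1 k k + ∑ n ∈ Finset.univ.erase k, x.2 k n) :=
      mul_le_mul_of_nonneg_left (hx1 k) (sub_nonneg.2 hp1)
    have h2 : p * (A k + δ') ≤ p * (a + δ') :=
      mul_le_mul_of_nonneg_left (by linarith [hAa k]) hp0.le
    nlinarith [mul_pos hp0 hε, mul_pos hp0 (hr k)]
  · simp only [θ, if_neg (Ne.symm hnk)]
    rw [div_mul_cancel₀ _ (hθpos k n hnk).ne']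
    constructor <;> linarith

end Network

/-! ### Lyapunov drift -/

/-- What the stability proof needs of the arrivals: they are dominated by random variables with
bounded second moments, and their correlation with the queues is at most that of arrivals of mean
rate `A`, up to an arbitrarily small error. -/
structure ModerateArrivals {N Ω : Type*} [MeasurableSpace Ω] (μ : Measure Ω) (A : N → ℝ)
    (lam y : ℕ → N → Ω → ℝ) : Prop where
  nonneg : ∀ᵐ ω ∂μ, ∀ t k, 0 ≤ y t k ω
  dominated : ∃ (Y : ℕ → N → Ω → ℝ) (m : N → ℝ), (∀ t k, MemLp (Y t k) 2 μ) ∧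
    (∀ t k, ∫ ω, Y t k ω ^ 2 ∂μ ≤ m k) ∧ ∀ᵐ ω ∂μ, ∀ t k, y t k ω ≤ Y t k ω
  correlation : ∀ σ > 0, ∃ K : N → ℝ, ∀ t k, MemLp (lam t k) 2 μ →
    ∃ Z : Ω → ℝ, Integrable Z μ ∧ (∀ᵐ ω ∂μ, lam t k ω * y t k ω ≤ Z ω) ∧
      ∫ ω, Z ω ∂μ ≤ ∫ ω, (A k + σ) * lam t k ω ∂μ + K k

theorem memLp_of_nonneg_of_le_add {Ω : Type*} [MeasurableSpace Ω] {μ : Measure Ω} {p : ENNReal}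
    {X X' Y : Ω → ℝ} (hm : AEStronglyMeasurable X' μ) (hX : MemLp X p μ) (hY : MemLp Y p μ)
    (h0 : ∀ᵐ ω ∂μ, 0 ≤ X' ω) (h : ∀ᵐ ω ∂μ, X' ω ≤ X ω + Y ω) : MemLp X' p μ := by
  refine (hX.add hY).mono hm ?_
  filter_upwards [h0, h] with ω h1 h2
  rw [Real.norm_of_nonneg h1]
  exact h2.trans (le_abs_self _)

section Network

variable {N : Type*} [Fintype N] [DecidableEq N]

/-- The objective is linear in the rates with coefficients known at the start of the slot, hence
independent of the channel state; each product of expectations factors. -/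
theorem integral_totalObjective {Ω S : Type*} [MeasurableSpace S]
    {m : MeasurableSpace Ω} {mΩ : MeasurableSpace Ω} {μ : Measure Ω} [IsFiniteMeasure μ]
    {P : Measure S} {C : Ω → S} (hC : MeasurePreserving C μ P)
    (hind : Indep (MeasurableSpace.comap C inferInstance) m μ)
    {lam : N → Ω → ℝ} {eta Q : N → N → Ω → ℝ} (hlm : ∀ k, Measurable[m] (lam k))
    (hem : ∀ n k, n ≠ k → Measurable[m] (eta n k)) (hQm : ∀ n k, n ≠ k → Measurable[m] (Q n k))
    (hli : ∀ k, Integrable (lam k) μ) (hei : ∀ n k, n ≠ k → Integrable (eta n k) μ)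
    (hQi : ∀ n k, n ≠ k → Integrable (Q n k) μ)
    {G : S → (N → N → ℝ) × (N → N → ℝ)} (hG : Integrable G P) :
    Integrable (fun ω => totalObjective (fun k => lam k ω) (fun n k => eta n k ω)
      (fun n k => Q n k ω) (G (C ω))) μ ∧
    Integrable (fun ω => totalObjective (fun k => lam k ω) (fun n k => eta n k ω)
      (fun n k => Q n k ω) (∫ s, G s ∂P)) μ ∧
    ∫ ω, totalObjective (fun k => lam k ω) (fun n k => eta n k ω)
      (fun n k => Q n k ω) (G (C ω)) ∂μ =
    ∫ ω, totalObjective (fun k => lam k ω) (fun n k => eta n k ω)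
      (fun n k => Q n k ω) (∫ s, G s ∂P) ∂μ := by
  have hG1 : ∀ k n, Integrable (fun s => (G s).1 k n) P := fun k n => (hG.fst.eval k).eval n
  have hG2 : ∀ k n, Integrable (fun s => (G s).2 k n) P := fun k n => (hG.snd.eval k).eval n
  have hx1 : ∀ k n, (∫ s, G s ∂P).1 k n = ∫ s, (G s).1 k n ∂P := fun k n => by
    rw [fst_integral hG, eval_integral (fun k => hG.fst.eval k), eval_integral (fun n => hG1 k n)]
  have hx2 : ∀ k n, (∫ s, G s ∂P).2 k n = ∫ s, (G s).2 k n ∂P := fun k n => by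
    rw [snd_integral hG, eval_integral (fun k => hG.snd.eval k), eval_integral (fun n => hG2 k n)]
  have hmul : ∀ {X : Ω → ℝ} {g : S → ℝ}, Measurable[m] X → Integrable X μ → Integrable g P →
      (Integrable (fun ω => X ω * g (C ω)) μ ∧
        ∫ ω, X ω * g (C ω) ∂μ = ∫ ω, X ω * (∫ s, g s ∂P) ∂μ) ∧
      Integrable (fun ω => X ω * (∫ s, g s ∂P)) μ := fun hX hXi hg =>
    ⟨Indep.integrable_mul_comp hC hind hX hXi hg, hXi.mul_const _⟩
  have h1 := fun k => hmul (hlm k) (hli k) (hG1 k k)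
  have h2 := fun k n (hn : n ∈ Finset.univ.erase k) =>
    have hne := (Finset.ne_of_mem_erase hn).symm
    hmul ((hem k n hne).sub (hQm k n hne)) ((hei k n hne).sub (hQi k n hne)) (hG1 k n)
  have h3 := fun k n (hn : n ∈ Finset.univ.erase k) =>
    have hne := Finset.ne_of_mem_erase hn
    hmul (((hlm k).sub (hem n k hne)).add (hQm n k hne))
      (((hli k).sub (hei n k hne)).add (hQi n k hne)) (hG2 k n)
  simp only [totalObjective_apply, cellularObjective, localObjective, hx1, hx2]
  have e2 := fun k => integrable_sum_and_integral_eq (fun n hn => (h2 k n hn).1)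
    (fun n hn => (h2 k n hn).2)
  have i2 := fun k => integrable_finsetSum (Finset.univ.erase k) (fun n hn => (h2 k n hn).2)
  have e3 := fun k => integrable_sum_and_integral_eq (fun n hn => (h3 k n hn).1)
    (fun n hn => (h3 k n hn).2)
  have i3 := fun k => integrable_finsetSum (Finset.univ.erase k) (fun n hn => (h3 k n hn).2)
  have e3' := integrable_sum_and_integral_eq (s := Finset.univ) (fun k _ => e3 k) (fun k _ => i3 k)
  have i3' := integrable_finsetSum Finset.univ (fun k _ => i3 k)
  have e1 := integrable_sum_and_integral_eq (s := Finset.univ)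
    (fun k _ => ⟨(h1 k).1.1.add (e2 k).1,
      (integral_add (h1 k).1.1 (e2 k).1).trans ((congrArg₂ (· + ·) (h1 k).1.2 (e2 k).2).trans
        (integral_add (h1 k).2 (i2 k)).symm)⟩) (fun k _ => (h1 k).2.add (i2 k))
  have i1 := integrable_finsetSum Finset.univ (fun k _ => (h1 k).2.add (i2 k))
  exact ⟨e1.1.add e3'.1, i1.add i3', (integral_add e1.1 e3'.1).trans
    ((congrArg₂ (· + ·) e1.2 e3'.2).trans (integral_add i1 i3').symm)⟩

/-- The change of the sum of squares of the queues in one slot. -/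
theorem sum_sq_le {lam lam' y : N → ℝ} {eta eta' Q Q' gs r : N → N → ℝ} {b β : ℝ} (hβ : 0 ≤ β)
    (hl : ∀ k, 0 ≤ lam k) (hl' : ∀ k, 0 ≤ lam' k) (hy : ∀ k, 0 ≤ y k)
    (he : ∀ n k, n ≠ k → 0 ≤ eta n k) (he' : ∀ n k, n ≠ k → 0 ≤ eta' n k)
    (hQ : ∀ n k, n ≠ k → 0 ≤ Q n k) (hQ' : ∀ n k, n ≠ k → 0 ≤ Q' n k)
    (hgs : ∀ k n, 0 ≤ gs k n ∧ gs k n ≤ b) (hr : ∀ k n, n ≠ k → 0 ≤ r k n ∧ r k n ≤ b)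
    (hls : ∀ k, lam' k ≤ max (lam k - gs k k - ∑ n ∈ Finset.univ.erase k, r k n) 0 + y k)
    (hes : ∀ n k, n ≠ k → eta' n k ≤ max (eta n k - gs n k) 0 + r k n)
    (hQs : ∀ n k, n ≠ k → Q' n k ≤ max (max (Q n k - r k n) 0 + (gs n k - β)) 0) :
    ∑ k, (lam' k ^ 2 + ∑ n ∈ Finset.univ.erase k, (eta' n k ^ 2 + Q' n k ^ 2)) ≤
      ∑ k, (lam k ^ 2 + ∑ n ∈ Finset.univ.erase k, (eta n k ^ 2 + Q n k ^ 2)) +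
      ∑ k, (((1 + Fintype.card N) * b) ^ 2 + y k ^ 2 +
        ∑ _n ∈ Finset.univ.erase k, (6 * b ^ 2 + 2 * β ^ 2)) +
      2 * (∑ k, (lam k * y k - ∑ n ∈ Finset.univ.erase k, β * Q n k) -
        totalObjective lam eta Q (gs, r)) := by
  rw [totalObjective_eq, ← Finset.sum_sub_distrib, Finset.mul_sum, ← Finset.sum_add_distrib,
    ← Finset.sum_add_distrib]
  refine Finset.sum_le_sum fun k _ => ?_
  have hsum0 : 0 ≤ ∑ n ∈ Finset.univ.erase k, r k n :=
    Finset.sum_nonneg fun n hn => (hr k n (Finset.ne_of_mem_erase hn)).1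
  have hb : 0 ≤ b := (hgs k k).1.trans (hgs k k).2
  have hsum : ∑ n ∈ Finset.univ.erase k, r k n ≤ Fintype.card N * b := by
    calc ∑ n ∈ Finset.univ.erase k, r k n ≤ ∑ _n ∈ Finset.univ.erase k, b :=
          Finset.sum_le_sum fun n hn => (hr k n (Finset.ne_of_mem_erase hn)).2
      _ ≤ ∑ _n : N, b :=
          Finset.sum_le_sum_of_subset_of_nonneg (Finset.erase_subset _ _) fun _ _ _ => hb
      _ = Fintype.card N * b := by simp
  set s := gs k k + ∑ n ∈ Finset.univ.erase k, r k n with hs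
  have hs0 : 0 ≤ s := add_nonneg (hgs k k).1 hsum0
  have hsb : s ≤ (1 + Fintype.card N) * b := by
    rw [add_mul, one_mul]; exact add_le_add (hgs k k).2 hsum
  have h1 : lam' k ^ 2 ≤ lam k ^ 2 + s ^ 2 + y k ^ 2 + 2 * (lam k * (y k - s)) :=
    sq_le_of_le_max_sub_add (hl k) (hl' k) hs0 (hy k) (by rw [hs, ← sub_sub]; exact hls k)
  have h2 : s ^ 2 ≤ ((1 + Fintype.card N) * b) ^ 2 := pow_le_pow_left₀ hs0 hsb 2
  have h3 : ∑ n ∈ Finset.univ.erase k, (eta' n k ^ 2 + Q' n k ^ 2) ≤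
      ∑ n ∈ Finset.univ.erase k, ((eta n k ^ 2 + Q n k ^ 2) + (6 * b ^ 2 + 2 * β ^ 2) -
        2 * (β * Q n k) - 2 * (eta n k * (gs n k - r k n) + Q n k * (r k n - gs n k))) := by
    refine Finset.sum_le_sum fun n hn => ?_
    have hne := Finset.ne_of_mem_erase hn
    obtain ⟨hg0, hgb⟩ := hgs n k
    obtain ⟨hr0, hrb⟩ := hr k n hne
    have h4 := sq_le_of_le_max_sub_add (he n k hne) (he' n k hne) hg0 hr0 (hes n k hne)
    have h5 := sq_le_of_le_max_max_sub_add (hQ n k hne) (hQ' n k hne) (hQs n k hne)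
    have h6 : gs n k ^ 2 ≤ b ^ 2 := pow_le_pow_left₀ hg0 hgb 2
    have h7 : r k n ^ 2 ≤ b ^ 2 := pow_le_pow_left₀ hr0 hrb 2
    -- The squares amount to `2 * b ^ 2` from `eta` and to `4 * b ^ 2 + 2 * β ^ 2` from `Q`; in `(gs
    -- n k - β) ^ 2` the cross term is dropped.
    nlinarith [mul_nonneg hg0 hβ]
  have h4 : ∑ n ∈ Finset.univ.erase k, ((eta n k ^ 2 + Q n k ^ 2) + (6 * b ^ 2 + 2 * β ^ 2) -
        2 * (β * Q n k) - 2 * (eta n k * (gs n k - r k n) + Q n k * (r k n - gs n k))) =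
      ∑ n ∈ Finset.univ.erase k, (eta n k ^ 2 + Q n k ^ 2) +
        ∑ _n ∈ Finset.univ.erase k, (6 * b ^ 2 + 2 * β ^ 2) -
        2 * ∑ n ∈ Finset.univ.erase k, β * Q n k -
        2 * ∑ n ∈ Finset.univ.erase k,
          (eta n k * (gs n k - r k n) + Q n k * (r k n - gs n k)) := by
    rw [Finset.sum_sub_distrib, Finset.sum_sub_distrib,
      Finset.sum_add_distrib (f := fun n => eta n k ^ 2 + Q n k ^ 2), Finset.mul_sum,
      Finset.mul_sum]
  linarith

/-- A nonnegative function bounded by the drift of a nonnegative function has bounded averages. -/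
theorem exists_average_le {L X : ℕ → ℝ} {K σ : ℝ} (hσ : 0 < σ) (hL : ∀ t, 0 ≤ L t)
    (h : ∀ t, L (t + 1) ≤ L t + K - σ * X t) :
    ∃ B : ℝ, ∀ T : ℕ, 1 ≤ T → (1 / (T : ℝ)) * ∑ t ∈ Finset.range T, X t ≤ B := by
  have key : ∀ T : ℕ, σ * ∑ t ∈ Finset.range T, X t ≤ L 0 + K * T - L T := by
    intro T
    induction T with
    | zero => simp
    | succ T ih =>
      rw [Finset.sum_range_succ, mul_add]
      push_cast
      linarith [h T]
  refine ⟨(L 0 + K) / σ, fun T hT => ?_⟩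
  have hT1 : (1 : ℝ) ≤ T := by exact_mod_cast hT
  have hT0 : (0 : ℝ) < T := by linarith
  rw [one_div, inv_mul_le_iff₀ hT0, mul_div_assoc', le_div_iff₀ hσ, mul_comm _ σ]
  nlinarith [key T, hL T, hL 0]

variable {𝒞 : Type u} [MeasurableSpace 𝒞] {𝒲 : Type v} [MeasurableSpace 𝒲]
  {𝒜 : Type*} {P : Measure (𝒞 × 𝒲)} {Γc : 𝒞 → N → Set ℝ} {Γw : 𝒲 → Set 𝒜} {rate : 𝒜 → N → N → ℝ} {β : ℝ}
  {Ω : Type*} {mΩ : MeasurableSpace Ω} {μ : Measure Ω} {ℱ : Filtration ℕ mΩ}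
  {C : ℕ → Ω → 𝒞 × 𝒲} {y : ℕ → N → Ω → ℝ} {gs : ℕ → N → N → Ω → ℝ} {a : ℕ → Ω → 𝒜}
  {lam : ℕ → N → Ω → ℝ} {eta Q : ℕ → N → N → Ω → ℝ}

/-- DcC maximizes the total objective. -/
theorem IsDcCNetwork.totalObjective_le (h : IsDcCNetwork P Γc Γw rate β μ ℱ C y gs a lam eta Q) :
    ∀ᵐ ω ∂μ, ∀ t, ∀ x ∈ closure (convexHull ℝ (rateSet Γc Γw rate (C t ω))),
      totalObjective (fun k => lam t k ω) (fun n k => eta t n k ω) (fun n k => Q t n k ω) x ≤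
      totalObjective (fun k => lam t k ω) (fun n k => eta t n k ω) (fun n k => Q t n k ω)
        (fun k n => gs t k n ω, rate (a t ω)) := by
  filter_upwards [h.cellular_max, h.local_max] with ω h1 h2 t x hx
  refine le_of_mem_closure_convexHull _ (fun z hz => ?_) hx
  simp only [totalObjective_apply]
  refine add_le_add (Finset.sum_le_sum fun k _ =>
    h1 t k (cellularFeasible_of_mem_rateSet hz k)) ?_
  obtain ⟨α, hα, hz2⟩ := hz.2
  refine le_trans (le_of_eq ?_) (h2 t hα)
  simp only [localObjective, hz2]
  refine Finset.sum_congr rfl fun k _ => Finset.sum_congr rfl fun n hn => ?_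
  rw [offDiag, if_neg (Finset.ne_of_mem_erase hn)]

variable [MeasurableSpace 𝒜] [Zero 𝒜]

theorem LinkRegularity.rate_bounds (hreg : LinkRegularity P Γc Γw rate)
    (h : IsDcCNetwork P Γc Γw rate β μ ℱ C y gs a lam eta Q) :
    ∃ b : 𝒞 × 𝒲 → ℝ, MemLp b 2 P ∧ ∀ᵐ ω ∂μ, ∀ t,
      (∀ k n, 0 ≤ gs t k n ω ∧ gs t k n ω ≤ b (C t ω)) ∧
      ∀ k n, n ≠ k → 0 ≤ rate (a t ω) k n ∧ rate (a t ω) k n ≤ b (C t ω) := by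
  obtain ⟨b, hb, hbc, hbl⟩ := hreg.second_moment
  refine ⟨b, hb, ?_⟩
  filter_upwards [h.cellular_feasible, h.local_feasible] with ω h1 h2 t
  exact ⟨fun k n => ⟨(h1 t k).1 n, (Finset.le_sup' (fun n => gs t k n ω) (Finset.mem_univ n)).trans
    (hbc _ k _ (h1 t k).2)⟩, fun k n hnk => ⟨hreg.rate_nonneg _ _ (h2 t) k n hnk,
    hbl _ _ (h2 t) k n hnk⟩⟩

/-- Induction on `t`: in one slot each queue grows by at most a square-integrable variable, `Y t k`
or `b (C t)`. This makes the Lyapunov function integrable in every slot. -/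
theorem IsDcCNetwork.memLp (h : IsDcCNetwork P Γc Γw rate β μ ℱ C y gs a lam eta Q)
    (hreg : LinkRegularity P Γc Γw rate) (hβ : 0 ≤ β) {A : N → ℝ}
    (hy : ModerateArrivals μ A lam y) (t : ℕ) :
    (∀ k, MemLp (lam t k) 2 μ) ∧ (∀ n k, n ≠ k → MemLp (eta t n k) 2 μ) ∧
      ∀ n k, n ≠ k → MemLp (Q t n k) 2 μ := by
  obtain ⟨b, hb, hbounds⟩ := hreg.rate_bounds h
  obtain ⟨Y, -, hY, -, hyY⟩ := hy.dominated
  have hbC : ∀ t, MemLp (fun ω => b (C t ω)) 2 μ := fun t =>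
    hb.comp_measurePreserving (h.channel.measurePreserving t)
  induction t with
  | zero => exact ⟨h.lam_initial, h.eta_initial, h.Q_initial⟩
  | succ t ih =>
    obtain ⟨ih1, ih2, ih3⟩ := ih
    refine ⟨fun k => ?_, fun n k hnk => ?_, fun n k hnk => ?_⟩
    · refine memLp_of_nonneg_of_le_add
        ((h.lam_adapted (t + 1) k).mono (ℱ.le _) le_rfl).aestronglyMeasurable (ih1 k) (hY t k)
        (by filter_upwards [h.lam_nonneg] with ω hω using hω _ _) ?_
      filter_upwards [h.lam_step, hbounds, hyY, h.lam_nonneg] with ω h1 h2 h3 h4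
      refine (h1 t k).trans (add_le_add (max_le ?_ (h4 t k)) (h3 t k))
      have := Finset.sum_nonneg fun n (hn : n ∈ Finset.univ.erase k) =>
        ((h2 t).2 k n (Finset.ne_of_mem_erase hn)).1
      linarith [((h2 t).1 k k).1]
    · refine memLp_of_nonneg_of_le_add
        ((h.eta_adapted (t + 1) n k hnk).mono (ℱ.le _) le_rfl).aestronglyMeasurable (ih2 n k hnk)
        (hbC t) (by filter_upwards [h.eta_nonneg] with ω hω using hω _ _ _ hnk) ?_
      filter_upwards [h.eta_step, hbounds, h.eta_nonneg] with ω h1 h2 h4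
      refine (h1 t n k hnk).trans (add_le_add (max_le ?_ (h4 t n k hnk)) ((h2 t).2 k n hnk).2)
      linarith [((h2 t).1 n k).1]
    · refine memLp_of_nonneg_of_le_add
        ((h.Q_adapted (t + 1) n k hnk).mono (ℱ.le _) le_rfl).aestronglyMeasurable (ih3 n k hnk)
        (hbC t) (by filter_upwards [h.Q_nonneg] with ω hω using hω _ _ _ hnk) ?_
      filter_upwards [h.Q_step, hbounds, h.Q_nonneg] with ω h1 h2 h4
      have h5 := (h2 t).1 n k
      have h6 := h4 t n k hnk
      refine (h1 t n k hnk).trans (max_le (add_le_add (max_le ?_ h6) ?_) ?_)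
      · linarith [((h2 t).2 k n hnk).1]
      · linarith
      · linarith

end Network

theorem StronglyStable.of_le {Ω : Type*} [MeasurableSpace Ω] {μ : Measure Ω} {X Y : ℕ → Ω → ℝ}
    (hY : StronglyStable μ Y) (hX : ∀ t, Integrable (X t) μ)
    (h : ∀ᵐ ω ∂μ, ∀ t, 0 ≤ X t ω ∧ X t ω ≤ Y t ω) : StronglyStable μ X := by
  obtain ⟨hYi, B, hB⟩ := hY
  refine ⟨hX, B, fun T hT => le_trans ?_ (hB T hT)⟩
  refine mul_le_mul_of_nonneg_left (Finset.sum_le_sum fun t _ => ?_) (by positivity)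
  refine integral_mono_ae (hX t).abs (hYi t).abs ?_
  filter_upwards [h] with ω hω
  exact abs_le_abs_of_nonneg (hω t).1 (hω t).2

/-! ### Expected drift and stability under DcC -/

section Network

variable {N : Type*} [Fintype N] [DecidableEq N]
  {𝒞 : Type u} [MeasurableSpace 𝒞] {𝒲 : Type v} [MeasurableSpace 𝒲]
  {𝒜 : Type*} [MeasurableSpace 𝒜] [Zero 𝒜]
  {P : Measure (𝒞 × 𝒲)} {Γc : 𝒞 → N → Set ℝ} {Γw : 𝒲 → Set 𝒜} {rate : 𝒜 → N → N → ℝ} {β : ℝ}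
  {Ω : Type*} {mΩ : MeasurableSpace Ω} {μ : Measure Ω} {ℱ : Filtration ℕ mΩ}
  {C : ℕ → Ω → 𝒞 × 𝒲} {y : ℕ → N → Ω → ℝ} {gs : ℕ → N → N → Ω → ℝ} {a : ℕ → Ω → 𝒜}
  {lam : ℕ → N → Ω → ℝ} {eta Q : ℕ → N → N → Ω → ℝ} {A : N → ℝ}

/-- The expected drift of the sum of squares of the queues is negative when the queues are long. -/
theorem IsDcCNetwork.exists_drift [IsProbabilityMeasure μ] [IsProbabilityMeasure P]
    [StandardBorelSpace 𝒜] (h : IsDcCNetwork P Γc Γw rate β μ ℱ C y gs a lam eta Q)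
    (hreg : LinkRegularity P Γc Γw rate) (hrate : ∀ k n, Measurable fun a => rate a k n)
    (hrate0 : rate 0 = 0) (hβ : 0 < β) (hA : A ∈ interior (stabilityRegion P Γc Γw rate))
    (hy : ModerateArrivals μ A lam y) :
    ∃ σ > 0, ∃ K : ℝ, ∀ t,
      ∫ ω, ∑ k, (lam (t + 1) k ω ^ 2 +
        ∑ n ∈ Finset.univ.erase k, (eta (t + 1) n k ω ^ 2 + Q (t + 1) n k ω ^ 2)) ∂μ ≤
      ∫ ω, ∑ k, (lam t k ω ^ 2 +
        ∑ n ∈ Finset.univ.erase k, (eta t n k ω ^ 2 + Q t n k ω ^ 2)) ∂μ + K -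
      σ * ∫ ω, (∑ k, lam t k ω + ∑ k, ∑ n ∈ Finset.univ.erase k, (eta t n k ω + Q t n k ω)) ∂μ := by
  obtain ⟨-, σ, hσ, x, ⟨G, hG, hGF, rfl⟩, hx1, hx2⟩ := hreg.exists_slack hrate hrate0 hA hβ
  obtain ⟨b, hb, hbounds⟩ := hreg.rate_bounds h
  obtain ⟨Y, m, hY, hYm, hyY⟩ := hy.dominated
  obtain ⟨Kz, hKz⟩ := hy.correlation σ hσ
  set κ : ℝ := (1 + Fintype.card N) with hκ
  refine ⟨2 * σ, by positivity, ∑ k : N, ((κ ^ 2 * ∫ s, b s ^ 2 ∂P + m k) +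
    ∑ n ∈ Finset.univ.erase k, (6 * ∫ s, b s ^ 2 ∂P + 2 * β ^ 2)) + 2 * ∑ k, Kz k, fun t => ?_⟩
  have hC := h.channel.measurePreserving t
  obtain ⟨ml, me, mQ⟩ := h.memLp hreg hβ.le hy t
  obtain ⟨ml', me', mQ'⟩ := h.memLp hreg hβ.le hy (t + 1)
  have il := fun k => (ml k).integrable (by norm_num)
  have ie := fun n k hnk => (me n k hnk).integrable (by norm_num)
  have iQ := fun n k hnk => (mQ n k hnk).integrable (by norm_num)
  have isum : ∀ {l : N → Ω → ℝ} {e q : N → N → Ω → ℝ}, (∀ k, Integrable (l k) μ) →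
      (∀ n k, n ≠ k → Integrable (e n k) μ) → (∀ n k, n ≠ k → Integrable (q n k) μ) →
      Integrable (fun ω => ∑ k, (l k ω + ∑ n ∈ Finset.univ.erase k, (e n k ω + q n k ω))) μ :=
    fun hl he hq => integrable_finsetSum _ fun k _ => (hl k).add (integrable_finsetSum _ fun n hn =>
      (he n k (Finset.ne_of_mem_erase hn)).add (hq n k (Finset.ne_of_mem_erase hn)))
  have iL := isum (fun k => (ml k).integrable_sq) (fun n k hnk => (me n k hnk).integrable_sq)
    (fun n k hnk => (mQ n k hnk).integrable_sq)
  have iL' := isum (fun k => (ml' k).integrable_sq) (fun n k hnk => (me' n k hnk).integrable_sq)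
    (fun n k hnk => (mQ' n k hnk).integrable_sq)
  -- `Z k` stands in for `lam t k * y t k`, whose measurability is not known.
  choose Z hZi hZ hZint using fun k => hKz t k (ml k)
  obtain ⟨iG, ix, hGx⟩ := integral_totalObjective hC (h.channel_indep t) (h.lam_adapted t)
    (h.eta_adapted t) (h.Q_adapted t) il ie iQ hG
  have hbi : Integrable (fun ω => b (C t ω) ^ 2) μ := (hb.comp_measurePreserving hC).integrable_sq
  have hbint : ∫ ω, b (C t ω) ^ 2 ∂μ = ∫ s, b s ^ 2 ∂P := by
    rw [← hC.map_eq, integral_map hC.aemeasurable]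
    rw [hC.map_eq]
    exact hb.integrable_sq.aestronglyMeasurable
  have i6 : Integrable (fun ω => 6 * b (C t ω) ^ 2 + 2 * β ^ 2) μ :=
    (hbi.const_mul 6).add (integrable_const _)
  have ib : ∀ k, Integrable (fun ω => (κ * b (C t ω)) ^ 2 + Y t k ω ^ 2) μ := fun k => by
    simp only [mul_pow]
    exact (hbi.const_mul _).add (hY t k).integrable_sq
  have ib6 : ∀ k, Integrable (fun ω => ((κ * b (C t ω)) ^ 2 + Y t k ω ^ 2) +
      ∑ _n ∈ Finset.univ.erase k, (6 * b (C t ω) ^ 2 + 2 * β ^ 2)) μ := fun k =>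
    (ib k).add (integrable_finsetSum _ fun _ _ => i6)
  have i7 : Integrable (fun ω => ∑ k, (((κ * b (C t ω)) ^ 2 + Y t k ω ^ 2) +
      ∑ _n ∈ Finset.univ.erase k, (6 * b (C t ω) ^ 2 + 2 * β ^ 2))) μ :=
    integrable_finsetSum _ fun k _ => ib6 k
  have iβ : ∀ k, Integrable (fun ω => ∑ n ∈ Finset.univ.erase k, β * Q t n k ω) μ := fun k =>
    integrable_finsetSum _ fun n hn => (iQ n k (Finset.ne_of_mem_erase hn)).const_mul β
  have iZk : ∀ k, Integrable (fun ω => Z k ω - ∑ n ∈ Finset.univ.erase k, β * Q t n k ω) μ :=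
    fun k => (hZi k).sub (iβ k)
  have iZβ : Integrable (fun ω => ∑ k, (Z k ω - ∑ n ∈ Finset.univ.erase k, β * Q t n k ω)) μ :=
    integrable_finsetSum _ fun k _ => iZk k
  have iA : ∀ k, Integrable (fun ω => (A k + σ) * lam t k ω) μ := fun k => (il k).const_mul _
  have iAk : ∀ k, Integrable (fun ω => (A k + σ) * lam t k ω -
      ∑ n ∈ Finset.univ.erase k, β * Q t n k ω) μ := fun k => (iA k).sub (iβ k)
  have iAβ : Integrable (fun ω => ∑ k, ((A k + σ) * lam t k ω -
      ∑ n ∈ Finset.univ.erase k, β * Q t n k ω)) μ :=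
    integrable_finsetSum _ fun k _ => iAk k
  -- pointwise drift
  have h1 := integral_mono_ae iL' ((iL.add i7).add ((iZβ.sub iG).const_mul 2)) (by
    filter_upwards [hbounds, hyY, ae_all_iff.2 hZ, h.lam_nonneg, h.eta_nonneg, h.Q_nonneg,
      h.lam_step, h.eta_step, h.Q_step, hy.nonneg, h.totalObjective_le,
      hC.quasiMeasurePreserving.ae hGF] with ω e1 e2 e3 e4 e5 e6 e7 e8 e9 e10 e11 e12
    have d1 := sum_sq_le (lam := fun k => lam t k ω) (eta := fun n k => eta t n k ω)
      (Q := fun n k => Q t n k ω) hβ.le (e4 t) (e4 (t + 1)) (e10 t) (e5 t) (e5 (t + 1)) (e6 t)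
      (e6 (t + 1)) (e1 t).1 (e1 t).2 (e7 t) (e8 t) (e9 t)
    refine d1.trans (add_le_add (add_le_add le_rfl (Finset.sum_le_sum fun k _ =>
      add_le_add (add_le_add le_rfl (pow_le_pow_left₀ (e10 t k) (e2 t k) 2)) le_rfl))
      (mul_le_mul_of_nonneg_left (sub_le_sub (Finset.sum_le_sum fun k _ =>
        sub_le_sub_right (e3 k) _) (e11 t _ e12)) zero_le_two)))
  have h2 : ∫ ω, ((∑ k, (lam t k ω ^ 2 +
        ∑ n ∈ Finset.univ.erase k, (eta t n k ω ^ 2 + Q t n k ω ^ 2))) +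
      (∑ k, (((κ * b (C t ω)) ^ 2 + Y t k ω ^ 2) +
        ∑ _n ∈ Finset.univ.erase k, (6 * b (C t ω) ^ 2 + 2 * β ^ 2))) +
      2 * (∑ k, (Z k ω - ∑ n ∈ Finset.univ.erase k, β * Q t n k ω) -
        totalObjective (fun k => lam t k ω) (fun n k => eta t n k ω) (fun n k => Q t n k ω)
          (G (C t ω)))) ∂μ = _ :=
    (integral_add (iL.add i7) ((iZβ.sub iG).const_mul 2)).trans (congrArg₂ (· + ·)
      (integral_add iL i7) ((integral_const_mul 2 _).trans
        (congrArg (2 * ·) ((integral_sub iZβ iG).trans (congrArg (_ - ·) hGx)))))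
  have h3 : ∫ ω, ∑ k, (((κ * b (C t ω)) ^ 2 + Y t k ω ^ 2) +
        ∑ _n ∈ Finset.univ.erase k, (6 * b (C t ω) ^ 2 + 2 * β ^ 2)) ∂μ ≤
      ∑ k : N, ((κ ^ 2 * ∫ s, b s ^ 2 ∂P + m k) +
        ∑ n ∈ Finset.univ.erase k, (6 * ∫ s, b s ^ 2 ∂P + 2 * β ^ 2)) := by
    rw [integral_finsetSum _ fun k _ => ib6 k]
    refine Finset.sum_le_sum fun k _ => ?_
    rw [integral_add (ib k) (integrable_finsetSum _ fun _ _ => i6),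
      integral_finsetSum _ fun _ _ => i6, integral_add (hbi.const_mul 6) (integrable_const _),
      integral_const_mul, hbint]
    refine add_le_add ?_ (by simp)
    simp only [mul_pow]
    rw [integral_add (hbi.const_mul _) (hY t k).integrable_sq, integral_const_mul, hbint]
    exact add_le_add le_rfl (hYm t k)
  have h4 : ∫ ω, ∑ k, (Z k ω - ∑ n ∈ Finset.univ.erase k, β * Q t n k ω) ∂μ ≤
      ∫ ω, ∑ k, ((A k + σ) * lam t k ω - ∑ n ∈ Finset.univ.erase k, β * Q t n k ω) ∂μ +
        ∑ k, Kz k := by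
    rw [integral_finsetSum _ fun k _ => iZk k,
      integral_finsetSum _ fun k _ => iAk k, ← Finset.sum_add_distrib]
    refine Finset.sum_le_sum fun k _ => ?_
    rw [integral_sub (hZi k) (iβ k), integral_sub (iA k) (iβ k)]
    linarith [hZint k]
  have itot : Integrable (fun ω => ∑ k, lam t k ω +
      ∑ k, ∑ n ∈ Finset.univ.erase k, (eta t n k ω + Q t n k ω)) μ := by
    simp only [← Finset.sum_add_distrib]
    simpa only [Finset.sum_add_distrib] using isum il ie iQ
  have h5 : ∫ ω, (∑ k, ((A k + σ) * lam t k ω - ∑ n ∈ Finset.univ.erase k, β * Q t n k ω)) ∂μ -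
      ∫ ω, totalObjective (fun k => lam t k ω) (fun n k => eta t n k ω) (fun n k => Q t n k ω)
        (∫ s, G s ∂P) ∂μ ≤
      - (σ * ∫ ω, (∑ k, lam t k ω +
        ∑ k, ∑ n ∈ Finset.univ.erase k, (eta t n k ω + Q t n k ω)) ∂μ) := by
    rw [← integral_sub iAβ ix, ← integral_const_mul, ← integral_neg]
    refine integral_mono_ae (iAβ.sub ix) (itot.const_mul σ).neg ?_
    filter_upwards [h.lam_nonneg, h.eta_nonneg, h.Q_nonneg] with ω e4 e5 e6
    simp only [totalObjective_eq]
    rw [← Finset.sum_sub_distrib, ← Finset.sum_add_distrib, Finset.mul_sum,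
      ← Finset.sum_neg_distrib]
    refine Finset.sum_le_sum fun k _ => ?_
    -- Of the slack `2 * σ`, one `σ` absorbs the correlation error in `A k + σ`; the other remains
    -- as drift.
    have e7 := mul_le_mul_of_nonneg_left (hx1 k) (e4 t k)
    have e8 : ∑ n ∈ Finset.univ.erase k, (σ * (eta t n k ω + Q t n k ω) - β * Q t n k ω) ≤
        ∑ n ∈ Finset.univ.erase k, (eta t n k ω * ((∫ s, G s ∂P).1 n k - (∫ s, G s ∂P).2 k n) +
          Q t n k ω * ((∫ s, G s ∂P).2 k n - (∫ s, G s ∂P).1 n k)) := by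
      refine Finset.sum_le_sum fun n hn => ?_
      have hne := Finset.ne_of_mem_erase hn
      obtain ⟨f1, f2⟩ := hx2 k n hne
      nlinarith [mul_nonneg (e5 t n k hne) (sub_nonneg.2 f1),
        mul_nonneg (e6 t n k hne) (sub_nonneg.2 f2)]
    rw [Finset.sum_sub_distrib, ← Finset.mul_sum] at e8
    linarith
  have h6 := h1.trans_eq h2
  linarith

/-- Telescoping the drift bounds the averages of the total queue size, and each queue lies between 0
and that total. -/
theorem IsDcCNetwork.networkStable [IsProbabilityMeasure μ] [IsProbabilityMeasure P]
    [StandardBorelSpace 𝒜] (h : IsDcCNetwork P Γc Γw rate β μ ℱ C y gs a lam eta Q)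
    (hreg : LinkRegularity P Γc Γw rate) (hrate : ∀ k n, Measurable fun a => rate a k n)
    (hrate0 : rate 0 = 0) (hβ : 0 < β) (hA : A ∈ interior (stabilityRegion P Γc Γw rate))
    (hy : ModerateArrivals μ A lam y) : NetworkStable μ lam eta Q := by
  obtain ⟨σ, hσ, K, hdrift⟩ := h.exists_drift hreg hrate hrate0 hβ hA hy
  have il := fun t k => ((h.memLp hreg hβ.le hy t).1 k).integrable (by norm_num)
  have ie := fun t n k hnk => ((h.memLp hreg hβ.le hy t).2.1 n k hnk).integrable (by norm_num)
  have iQ := fun t n k hnk => ((h.memLp hreg hβ.le hy t).2.2 n k hnk).integrable (by norm_num)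
  have hnn : ∀ᵐ ω ∂μ, ∀ t, (∀ k, 0 ≤ lam t k ω) ∧
      ∀ k, ∀ n ∈ Finset.univ.erase k, 0 ≤ eta t n k ω ∧ 0 ≤ Q t n k ω := by
    filter_upwards [h.lam_nonneg, h.eta_nonneg, h.Q_nonneg] with ω e1 e2 e3 t
    exact ⟨e1 t, fun k n hn => ⟨e2 t n k (Finset.ne_of_mem_erase hn),
      e3 t n k (Finset.ne_of_mem_erase hn)⟩⟩
  have htot : StronglyStable μ (fun t ω => ∑ k, lam t k ω +
      ∑ k, ∑ n ∈ Finset.univ.erase k, (eta t n k ω + Q t n k ω)) := by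
    refine ⟨fun t => ?_, ?_⟩
    · exact (integrable_finsetSum _ fun k _ => il t k).add (integrable_finsetSum _ fun k _ =>
        integrable_finsetSum _ fun n hn => (ie t n k (Finset.ne_of_mem_erase hn)).add
          (iQ t n k (Finset.ne_of_mem_erase hn)))
    · obtain ⟨B, hB⟩ := exists_average_le (L := fun t => ∫ ω, ∑ k, (lam t k ω ^ 2 +
        ∑ n ∈ Finset.univ.erase k, (eta t n k ω ^ 2 + Q t n k ω ^ 2)) ∂μ) hσ (fun t => integral_nonneg fun ω =>
        Finset.sum_nonneg fun k _ => add_nonneg (sq_nonneg _) (Finset.sum_nonneg fun n _ =>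
          add_nonneg (sq_nonneg _) (sq_nonneg _))) hdrift
      refine ⟨B, fun T hT => le_trans (le_of_eq ?_) (hB T hT)⟩
      congr 1
      refine Finset.sum_congr rfl fun t _ => integral_congr_ae ?_
      filter_upwards [hnn] with ω hω
      exact abs_of_nonneg (add_nonneg (Finset.sum_nonneg fun k _ => (hω t).1 k)
        (Finset.sum_nonneg fun k _ => Finset.sum_nonneg fun n hn =>
          add_nonneg ((hω t).2 k n hn).1 ((hω t).2 k n hn).2))
  have hpair : ∀ᵐ ω ∂μ, ∀ t n k, n ≠ k → 0 ≤ eta t n k ω ∧ 0 ≤ Q t n k ω ∧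
      eta t n k ω + Q t n k ω ≤ ∑ k, lam t k ω +
        ∑ k, ∑ n ∈ Finset.univ.erase k, (eta t n k ω + Q t n k ω) := by
    filter_upwards [hnn] with ω hω t n k hnk
    have hmem : n ∈ Finset.univ.erase k := Finset.mem_erase.2 ⟨hnk, Finset.mem_univ n⟩
    have hterm : ∀ k, ∀ n ∈ Finset.univ.erase k, 0 ≤ eta t n k ω + Q t n k ω := fun k n hn =>
      add_nonneg ((hω t).2 k n hn).1 ((hω t).2 k n hn).2
    refine ⟨((hω t).2 k n hmem).1, ((hω t).2 k n hmem).2, ?_⟩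
    refine (Finset.single_le_sum (hterm k) hmem).trans ?_
    refine (Finset.single_le_sum (f := fun k => ∑ n ∈ Finset.univ.erase k,
      (eta t n k ω + Q t n k ω)) (fun k _ => Finset.sum_nonneg (hterm k))
      (Finset.mem_univ k)).trans ?_
    exact le_add_of_nonneg_left (Finset.sum_nonneg fun k _ => (hω t).1 k)
  refine ⟨fun k => htot.of_le (fun t => il t k) ?_, fun n k hnk => htot.of_le
    (fun t => ie t n k hnk) ?_, fun n k hnk => htot.of_le (fun t => iQ t n k hnk) ?_, htot⟩
  · filter_upwards [hnn] with ω hω t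
    refine ⟨(hω t).1 k, ?_⟩
    refine (Finset.single_le_sum (fun k _ => (hω t).1 k) (Finset.mem_univ k)).trans ?_
    exact le_add_of_nonneg_right (Finset.sum_nonneg fun k _ => Finset.sum_nonneg fun n hn =>
      add_nonneg ((hω t).2 k n hn).1 ((hω t).2 k n hn).2)
  · filter_upwards [hpair] with ω hω t
    obtain ⟨h1, h2, h3⟩ := hω t n k hnk
    exact ⟨h1, by linarith⟩
  · filter_upwards [hpair] with ω hω t
    obtain ⟨h1, h2, h3⟩ := hω t n k hnk
    exact ⟨h2, by linarith⟩

end Network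

/-! ### The two kinds of arrivals -/

/-- Independence of the past gives correlation exactly `A k` times the mean queue, so `K = 0` works;
identical distribution makes the second-moment bound uniform in time. -/
theorem ExogenousArrivals.moderate {N Ω : Type*} {mΩ : MeasurableSpace Ω} {μ : Measure Ω}
    [IsFiniteMeasure μ] {ℱ : Filtration ℕ mΩ} {A : N → ℝ} {lam y : ℕ → N → Ω → ℝ}
    (h : ExogenousArrivals μ ℱ A y) (hlm : ∀ t k, Measurable[ℱ t] (lam t k))
    (hl : ∀ᵐ ω ∂μ, ∀ t k, 0 ≤ lam t k ω) : ModerateArrivals μ A lam y where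
  nonneg := h.nonneg
  dominated := by
    refine ⟨y, fun k => ∫ ω, y 0 k ω ^ 2 ∂μ, h.second_moment, fun t k => le_of_eq ?_, by simp⟩
    exact ((h.ident t k).comp (measurable_id.pow_const 2)).integral_eq
  correlation := by
    intro σ hσ
    refine ⟨0, fun t k hlam => ?_⟩
    have hyi := (h.second_moment t k).integrable (by norm_num)
    have hli := hlam.integrable (by norm_num)
    have hind : IndepFun (lam t k) (y t k) μ := by
      rw [IndepFun_iff_Indep]
      exact indep_of_indep_of_le_left (h.indep t k).symm (hlm t k).comap_le
    refine ⟨fun ω => lam t k ω * y t k ω, hind.integrable_mul hli hyi, by simp, ?_⟩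
    rw [hind.integral_fun_mul_eq_mul_integral hli.aestronglyMeasurable hyi.aestronglyMeasurable,
      h.mean, integral_const_mul, Pi.zero_apply, add_zero, mul_comm]
    refine mul_le_mul_of_nonneg_right (by linarith) (integral_nonneg_of_ae ?_)
    filter_upwards [hl] with ω hω using hω t k

/-- Arrivals are bounded by `R k`, and `lam * y ≤ σ * lam + K` holds pointwise by concavity. The
means of the arrivals play no role: `A k ≥ 0` suffices to insert `A k`. -/
theorem RateControlled.moderate {N Ω : Type*} [MeasurableSpace Ω] {μ : Measure Ω}
    [IsProbabilityMeasure μ] {M : ℝ} (hM : 0 < M) {U : N → ℝ → ℝ} {D : N → Set ℝ}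
    (hD : ∀ k, D k = Set.Ici 0 ∨ D k = Set.Ioi 0) (hU : ∀ k, StrictConcaveOn ℝ (D k) (U k))
    {R : N → ℝ} {A : N → ℝ} (hA : ∀ k, 0 ≤ A k) {lam y : ℕ → N → Ω → ℝ}
    (h : RateControlled μ M U D R lam y) (hl : ∀ᵐ ω ∂μ, ∀ t k, 0 ≤ lam t k ω) :
    ModerateArrivals μ A lam y where
  nonneg := by
    filter_upwards [h] with ω hω t k
    have := (hω t k).1.1
    rcases hD k with h1 | h1 <;> rw [h1] at this
    · exact this
    · exact le_of_lt this
  dominated := by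
    refine ⟨fun _ k _ => R k, fun k => R k ^ 2, fun t k => memLp_const _, fun t k => by simp, ?_⟩
    filter_upwards [h] with ω hω t k using (hω t k).1.2
  correlation := by
    intro σ hσ
    choose K hK0 hK using fun k => exists_mul_le_of_strictConcaveOn (hD k) (hU k) hM (R k) hσ
    refine ⟨K, fun t k hlam => ⟨fun ω => σ * lam t k ω + K k, ?_, ?_, ?_⟩⟩
    · exact ((hlam.integrable (by norm_num)).const_mul σ).add (integrable_const _)
    · filter_upwards [h, hl] with ω h1 h2
      exact hK k _ _ (h2 t k) (h1 t k).1 (h1 t k).2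
    · have hli := hlam.integrable (by norm_num)
      rw [integral_add (hli.const_mul σ) (integrable_const _), integral_const_mul,
        integral_const_mul]
      have : 0 ≤ ∫ ω, lam t k ω ∂μ := integral_nonneg_of_ae (by
        filter_upwards [hl] with ω hω using hω t k)
      simp only [integral_const, probReal_univ, smul_eq_mul, one_mul]
      nlinarith [mul_nonneg (hA k) this]

end DcC

/-! ### Unicast and broadcast as instances of one action space -/

theorem theorem1 {N : Type*} [Fintype N] [DecidableEq N]
    {𝒞 : Type u} [MeasurableSpace 𝒞] {𝒲 : Type v} [MeasurableSpace 𝒲]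
    {Ω : Type*} [mΩ : MeasurableSpace Ω] (μ : Measure Ω) [IsProbabilityMeasure μ]
    (ℱ : Filtration ℕ mΩ)
    -- law of the channel states, feasible cellular rates
    (P : Measure (𝒞 × 𝒲)) [IsProbabilityMeasure P] (Γc : 𝒞 → N → Set ℝ)
    -- utilities and their domains, parameters of the algorithm
    (U : N → ℝ → ℝ) (D : N → Set ℝ) (hD : ∀ k, D k = Set.Ici 0 ∨ D k = Set.Ioi 0)
    (hU : ∀ k, StrictConcaveOn ℝ (D k) (U k))
    (M : ℝ) (hM : 0 < M) (R : N → ℝ) (hR : ∀ k, 0 < R k) (β : ℝ) (hβ : 0 < β)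
    -- channel states, arrivals, cellular rates and queues
    (A : N → ℝ) (C : ℕ → Ω → 𝒞 × 𝒲) (y : ℕ → N → Ω → ℝ) (gs : ℕ → N → N → Ω → ℝ)
    (lam : ℕ → N → Ω → ℝ) (eta Q : ℕ → N → N → Ω → ℝ)
    (hy : DcC.ExogenousArrivals μ ℱ A y ∨ DcC.RateControlled μ M U D R lam y) :
    -- unicast
    (∀ (Γu : 𝒲 → Set (N → N → ℝ)) (gw : ℕ → Ω → N → N → ℝ),
      DcC.LinkRegularity P Γc Γu DcC.unicastRate →
      DcC.IsDcCNetwork P Γc Γu DcC.unicastRate β μ ℱ C y gs gw lam eta Q →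
      A ∈ interior (DcC.stabilityRegion P Γc Γu DcC.unicastRate) →
      DcC.NetworkStable μ lam eta Q) ∧
    -- broadcast
    (∀ (ℋ : Finset (Finset N)) (Γb : 𝒲 → Set (N → Finset N → ℝ))
        (f : ℕ → Ω → N → Finset N → ℝ),
      DcC.LinkRegularity P Γc Γb (DcC.broadcastRate ℋ) →
      DcC.IsDcCNetwork P Γc Γb (DcC.broadcastRate ℋ) β μ ℱ C y gs f lam eta Q →
      A ∈ interior (DcC.stabilityRegion P Γc Γb (DcC.broadcastRate ℋ)) →
      DcC.NetworkStable μ lam eta Q) := by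
  have main : ∀ {𝒜 : Type _} [MeasurableSpace 𝒜] [StandardBorelSpace 𝒜] [Zero 𝒜]
      {Γw : 𝒲 → Set 𝒜} {rate : 𝒜 → N → N → ℝ} {a : ℕ → Ω → 𝒜},
      (∀ k n, Measurable fun a => rate a k n) → rate 0 = 0 →
      DcC.LinkRegularity P Γc Γw rate →
      DcC.IsDcCNetwork P Γc Γw rate β μ ℱ C y gs a lam eta Q →
      A ∈ interior (DcC.stabilityRegion P Γc Γw rate) → DcC.NetworkStable μ lam eta Q := by
    intro 𝒜 _ _ _ Γw rate a hrate hrate0 hreg hnet hA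
    refine hnet.networkStable hreg hrate hrate0 hβ hA ?_
    rcases hy with hy | hy
    · exact hy.moderate hnet.lam_adapted hnet.lam_nonneg
    -- Nonnegativity of `A` comes from its membership in the stability region.
    · exact hy.moderate hM hD hU (hreg.exists_slack hrate hrate0 hA hβ).1 hnet.lam_nonneg
  refine ⟨fun Γu gw => main (fun k n => ?_) rfl, fun ℋ Γb f => main (fun k n => ?_) ?_⟩
  · unfold DcC.unicastRate
    fun_prop
  · unfold DcC.broadcastRate
    fun_prop
  · ext k n
    simp [DcC.broadcastRate]
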